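/- Let $\beta>0$, $\lambda>0$, $\nu\in(0,1]$, and let $N\ge 1$ be an integer. Consider the following generalized Yule model. Webpages are created according to a Yule process (linear birth process) of rate $\beta$ which starts at time $0$ with one webpage. Each webpage starts with one in-link, and the numbers of in-links of the webpages, as functions of the age of the webpage, are independent copies of a fractional nonlinear birth process $\mathfrak N^\nu(t)$, $t\ge0$, independent of the process of creation of webpages, with the saturating rates $\lambda_j=\lambda(N-j)$ for $1\le j\le N$ (the state $N$ is absorbing; put $\lambda_j=0$ for $j>N$). That is, $\mathfrak N^\nu$ is a counting process with unit jumps and $\mathfrak N^\nu(0)=1$ whose state probabilities $p_n(t)=\mathbb P(\mathfrak N^\nu(t)=n)$ are locally absolutely continuous and satisfy $$\frac{\mathrm d^\nu p_n}{\mathrm dt^\nu}=-\lambda_n p_n+\lambda_{n-1}p_{n-1},\quad n\ge1,\qquad p_0\equiv 0,\quad p_n(0)=\delta_{n,1},$$ for almost every $t>0$, where $\mathrm d^\nu/\mathrm dt^\nu$ is the Caputo derivative $\frac{\mathrm d^\nu f}{\mathrm dt^\nu}(t)=\frac1{\Gamma(1-\nu)}\int_0^t (t-s)^{-\nu}f'(s)\,\mathrm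 ds$ for $0<\nu<1$, and the ordinary derivative for $\nu=1$. Let ${}_t\mathfrak N^\nu_{s_1}$ be the number of in-links, at time $t$, of a webpage chosen uniformly at random among those present at time $t$. Then, as $t\to\infty$, ${}_t\mathfrak N^\nu_{s_1}$ converges in distribution to a random variable $\mathfrak N^\nu_{s_1}$, i.e. $\mathbb P({}_t\mathfrak N^\nu_{s_1}=n)\to\mathbb P(\mathfrak N^\nu_{s_1}=n)$ for every integer $n\ge0$, and, with $\rho=\lambda/\beta^\nu$, $$\mathbb P(\mathfrak N^\nu_{s_1}=n)=\binom{N-1}{N-n}\sum_{m=1}^n\binom{n-1}{m-1}(-1)^{n-m}\frac1{1+\rho(N-m)},\qquad 1\le n\le N.$$ -/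

import Mathlib

open MeasureTheory ProbabilityTheory Filter Topology
open scoped NNReal

noncomputable section

namespace FracYule

/-- The Caputo derivative of order `ν ∈ (0, 1]` with base point `0`; at `ν = 1` it is the
ordinary first derivative. -/
def caputoDeriv (ν : ℝ) (f : ℝ → ℝ) (t : ℝ) : ℝ :=
  if ν = 1 then deriv f t
  else (Real.Gamma (1 - ν))⁻¹ * ∫ s in (0 : ℝ)..t, (t - s) ^ (-ν) * deriv f s

section Network

variable {Ω : Type*}

/-- Creation time of webpage `k`; webpage `0` is present from time `0` on. -/
def creationTime (W : ℕ → Ω → ℝ) (k : ℕ) (ω : Ω) : ℝ := ∑ i ∈ Finset.range k, W i ω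

/-- The set of the webpages present at time `t`. -/
def pagesAt (W : ℕ → Ω → ℝ) (t : ℝ≥0) (ω : Ω) : Set ℕ := {k | creationTime W k ω ≤ t}

/-- The number of in-links, at time `t`, of the webpage `K ω`. -/
def pageSize (W : ℕ → Ω → ℝ) (M : ℕ → ℝ≥0 → Ω → ℕ) (t : ℝ≥0) (K : Ω → ℕ) (ω : Ω) : ℕ :=
  M (K ω) (t - creationTime W (K ω) ω).toNNReal ω

/-- The sigma-algebras generated by the single holding times `W i` of the webpage process
(left summand) and by the single in-link processes `M k` (right summand). -/
abbrev componentSigma (W : ℕ → Ω → ℝ) (M : ℕ → ℝ≥0 → Ω → ℕ) : ℕ ⊕ ℕ → MeasurableSpace Ω :=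
  Sum.elim (fun i => MeasurableSpace.comap (W i) inferInstance)
    (fun k => ⨆ s, MeasurableSpace.comap (M k s) inferInstance)

/-- The sigma-algebra generated by the whole network: all webpage creation times and all in-link
processes. -/
abbrev networkSigma (W : ℕ → Ω → ℝ) (M : ℕ → ℝ≥0 → Ω → ℕ) : MeasurableSpace Ω :=
  ⨆ i, componentSigma W M i

end Network

section Model

variable {Ω : Type*} [MeasurableSpace Ω]

/-- The state probability `p_n(t) = P(X(t) = n)` as a function of `t ≥ 0`
(extended by its value at `0` to negative `t`). -/
def stateProb (μ : Measure Ω) (X : ℝ≥0 → Ω → ℕ) (n : ℕ) (t : ℝ) : ℝ :=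
  μ.real {ω | X t.toNNReal ω = n}

/-- `X` is a fractional nonlinear birth process with fractionality parameter `ν` and birth rates
`r 1, r 2, …`, started from one progenitor: a counting process with unit jumps whose state
probabilities are locally absolutely continuous and solve
`d^ν p_n / dt^ν = - r n * p_n + r (n - 1) * p_{n-1}`, `n ≥ 1`, with the Caputo derivative
(which, for absolutely continuous functions, exists almost everywhere).
The conditions `p_n(0) = δ_{n,1}` and `p_0 = 0` hold because `X` starts in `1` and is monotone. -/
structure IsFractionalBirthProcess (μ : Measure Ω) (ν : ℝ) (r : ℕ → ℝ) (X : ℝ≥0 → Ω → ℕ) :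
    Prop where
  measurable : ∀ t, Measurable (X t)
  start : ∀ ω, X 0 ω = 1
  monotone : ∀ ω, Monotone fun t => X t ω
  rightCont : ∀ ω t, ContinuousWithinAt (fun s => X s ω) (Set.Ici t) t
  unitJumps : ∀ ω t, 0 < t → ∃ s < t, X t ω ≤ X s ω + 1
  absCont : ∀ n, 1 ≤ n → ∀ T : ℝ, 0 < T →
    AbsolutelyContinuousOnInterval (stateProb μ X n) 0 T
  governing : ∀ n, 1 ≤ n → ∀ᵐ t ∂(volume.restrict (Set.Ioi (0 : ℝ))),
    caputoDeriv ν (stateProb μ X n) t =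
      - r n * stateProb μ X n t + r (n - 1) * stateProb μ X (n - 1) t

/-- The generalized nonlinear Yule model. Webpages form a Yule process (linear birth process) of
rate `β` started from one webpage, given through its holding times: `W i` is the time
spent with exactly `i + 1` webpages, so the `W i` are independent and exponential with rates
`β * (i + 1)`. The webpages are numbered `0, 1, 2, …` in order of creation, and `M k s` is the
number of in-links of webpage `k` when its age is `s`. All holding times and all in-link processes
are mutually independent. -/
structure IsGeneralizedYuleModel (μ : Measure Ω) (β ν : ℝ) (r : ℕ → ℝ)
    (W : ℕ → Ω → ℝ) (M : ℕ → ℝ≥0 → Ω → ℕ) : Prop where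
  measurable_holding : ∀ i, Measurable (W i)
  law_holding : ∀ i : ℕ, HasLaw (W i) (expMeasure (β * (i + 1))) μ
  birth : ∀ k, IsFractionalBirthProcess μ ν r (M k)
  indep : iIndep (componentSigma W M) μ

open Classical in
/-- `K` is a webpage chosen uniformly at random among those present at time `t`: given the
network, `K` equals each of the webpages present with the same probability. -/
structure IsUniformPage (μ : Measure Ω) (W : ℕ → Ω → ℝ) (M : ℕ → ℝ≥0 → Ω → ℕ) (t : ℝ≥0)
    (K : Ω → ℕ) : Prop where
  measurable : Measurable K
  uniform : ∀ k, μ⟦K ⁻¹' {k} | networkSigma W M⟧ =ᵐ[μ]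
    fun ω => if k ∈ pagesAt W t ω then ((pagesAt W t ω).ncard : ℝ)⁻¹ else 0

end Model

/-- The saturating birth rates `λ_j = λ (N - j)` for `j ≤ N`; the subtraction is truncated, so the
rates vanish from the absorbing state `N` on. -/
def saturatingRate (lam : ℝ) (N : ℕ) (j : ℕ) : ℝ := lam * ((N - j : ℕ) : ℝ)

end FracYule

end

noncomputable section

namespace FracYule

/-! ### Fractional integration -/

section Volterra

/-! Let `T_k` be the creation times. Given the network, the chosen page is uniform among those
present, and the creation times are independent of each in-link process. Hence the probability of
size `n` at time `t` is the expectation of the average of `p_n(t - T_k)` over the pages present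
(`prob_pageSize_eq`).

Almost surely `T_k - log(k+1)/β` converges to a random `c`
(`ae_exists_tendsto_creationTime_sub_log`). So, if `m` pages are present, page `⌊u m⌋` has age about
`-log u / β`. The constant `c` cancels, and the ages become exponential of rate `β`
(`tendsto_average_ages`). The limit is therefore `L n = ∫ β e^{-βs} p_n(s) ds`.

To compute it, fractional integration turns the Caputo equation into a Volterra equation with kernel
`(t-s)^(ν-1)` (`sub_eq_fracIntegral_of_caputoDeriv`). Its Laplace transform at `β` gives `L n (1 +
ρ(N-n)) = δ_{n,1} + ρ(N-n+1) L (n-1)` for `1 ≤ n ≤ N` (`laplace_stateProb`). The explicit weights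
solve this recursion (`limitWeight_succ`), which also forces total mass one. Uniqueness for the
Volterra equation shows that all pages share the same `p_n`. -/

theorem integral_betaKernel_zero {ν a : ℝ} (h0 : 0 < ν) (h1 : ν < 1) (ha : 0 < a) :
    ∫ x in (0 : ℝ)..a, x ^ (-ν) * (a - x) ^ (ν - 1) = Real.Gamma ν * Real.Gamma (1 - ν) := by
  have h := Complex.betaIntegral_scaled ((1 - ν : ℝ) : ℂ) (ν : ℂ) ha
  rw [Complex.betaIntegral_eq_Gamma_mul_div _ _ (by simpa using h1) (by simpa using h0)] at h
  have e1 : ((1 - ν : ℝ) : ℂ) + (ν : ℂ) - 1 = 0 := by push_cast; ring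
  have e2 : ((1 - ν : ℝ) : ℂ) + (ν : ℂ) = 1 := by push_cast; ring
  rw [e1, e2, Complex.cpow_zero, Complex.Gamma_one, Complex.Gamma_ofReal, Complex.Gamma_ofReal,
    div_one, one_mul] at h
  have h2 : ∫ x in (0 : ℝ)..a, (x : ℂ) ^ (((1 - ν : ℝ) : ℂ) - 1) * ((a : ℂ) - x) ^ ((ν : ℂ) - 1)
      = ((∫ x in (0 : ℝ)..a, x ^ (-ν) * (a - x) ^ (ν - 1) : ℝ) : ℂ) := by
    rw [← intervalIntegral.integral_ofReal]
    refine intervalIntegral.integral_congr fun x hx => ?_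
    rw [Set.uIcc_of_le ha.le] at hx
    simp only [Complex.ofReal_mul, Complex.ofReal_cpow hx.1,
      Complex.ofReal_cpow (sub_nonneg.2 hx.2)]
    push_cast
    congr 2
    ring
  rw [h2, ← Complex.ofReal_mul] at h
  rw [Complex.ofReal_injective h, mul_comm]

/-- The exponents add up to `-1`, so the integral is scale invariant. That its value depends on
neither `u` nor `t` is what makes fractional integration invert the Caputo derivative. -/
theorem integral_betaKernel {ν u t : ℝ} (h0 : 0 < ν) (h1 : ν < 1) (hut : u < t) :
    ∫ s in u..t, (t - s) ^ (ν - 1) * (s - u) ^ (-ν) = Real.Gamma ν * Real.Gamma (1 - ν) := by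
  have h := integral_betaKernel_zero h0 h1 (sub_pos.2 hut)
  rw [← h]
  have := intervalIntegral.integral_comp_sub_right (a := u) (b := t)
    (fun x => x ^ (-ν) * (t - u - x) ^ (ν - 1)) u
  rw [sub_self] at this
  rw [← this]
  refine intervalIntegral.integral_congr fun x _ => ?_
  rw [mul_comm]
  congr 2
  ring

/-- The kernel `(t - s)^(ν-1) (s - u)^(-ν)` of iterated fractional integration, supported on
`u < s < t`. -/
def betaKernel (ν t : ℝ) (s u : ℝ) : ℝ :=
  Set.indicator (Set.Ioo u t) (fun s => (t - s) ^ (ν - 1) * (s - u) ^ (-ν)) s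

theorem betaKernel_nonneg (ν t s u : ℝ) : 0 ≤ betaKernel ν t s u := by
  refine Set.indicator_nonneg (fun x hx => ?_) s
  exact mul_nonneg (Real.rpow_nonneg (sub_nonneg.2 hx.2.le) _)
    (Real.rpow_nonneg (sub_nonneg.2 hx.1.le) _)

theorem integral_betaKernel_left {ν u t : ℝ} (h0 : 0 < ν) (h1 : ν < 1) (hut : u < t) :
    ∫ s, betaKernel ν t s u = Real.Gamma ν * Real.Gamma (1 - ν) := by
  rw [← integral_betaKernel h0 h1 hut, intervalIntegral.integral_of_le hut.le,
    integral_Ioc_eq_integral_Ioo, ← integral_indicator measurableSet_Ioo]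
  rfl

theorem integrable_betaKernel {ν u t : ℝ} (h0 : 0 < ν) (h1 : ν < 1) (hut : u < t) :
    Integrable fun s => betaKernel ν t s u := by
  -- The integral of a non-integrable function is `0` by convention, so a nonzero value certifies
  -- integrability.
  refine Integrable.of_integral_ne_zero ?_
  rw [integral_betaKernel_left h0 h1 hut]
  exact (mul_pos (Real.Gamma_pos_of_pos h0) (Real.Gamma_pos_of_pos (sub_pos.2 h1))).ne'

theorem measurable_betaKernel (ν t : ℝ) :
    Measurable fun p : ℝ × ℝ => betaKernel ν t p.1 p.2 := by
  have : (fun p : ℝ × ℝ => betaKernel ν t p.1 p.2) =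
      Set.indicator {p : ℝ × ℝ | p.2 < p.1 ∧ p.1 < t}
        (fun p => (t - p.1) ^ (ν - 1) * (p.1 - p.2) ^ (-ν)) := by
    ext p
    simp only [betaKernel, Set.indicator_apply, Set.mem_Ioo, Set.mem_ofPred_eq]
  rw [this]
  refine Measurable.indicator (by fun_prop) ?_
  exact (measurableSet_lt measurable_snd measurable_fst).inter
    (measurableSet_lt measurable_fst measurable_const)

/-- Fractional integration of order `ν` inverts the Caputo derivative of order `ν`. -/
theorem sub_eq_fracIntegral_of_caputoDeriv {ν : ℝ} (h0 : 0 < ν) (h1 : ν ≤ 1) {f g : ℝ → ℝ}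
    (hf : ∀ T : ℝ, 0 < T → AbsolutelyContinuousOnInterval f 0 T)
    (hg : ∀ᵐ t ∂(volume.restrict (Set.Ioi (0 : ℝ))), caputoDeriv ν f t = g t)
    {t : ℝ} (ht : 0 < t) :
    f t - f 0 = (Real.Gamma ν)⁻¹ * ∫ s in (0 : ℝ)..t, (t - s) ^ (ν - 1) * g s := by
  have hg' : ∀ᵐ s ∂(volume.restrict (Set.Ioc 0 t)), caputoDeriv ν f s = g s :=
    ae_restrict_of_ae_restrict_of_subset Set.Ioc_subset_Ioi_self hg
  have hftc := (hf t ht).integral_deriv_eq_sub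
  rcases h1.eq_or_lt with rfl | h1
  · rw [Real.Gamma_one, inv_one, one_mul, ← hftc]
    rw [intervalIntegral.integral_of_le ht.le, intervalIntegral.integral_of_le ht.le]
    refine integral_congr_ae ?_
    filter_upwards [hg'] with s hs
    rw [← hs]
    simp [caputoDeriv]
  set B := Real.Gamma ν * Real.Gamma (1 - ν) with hB
  have hG0 := Real.Gamma_pos_of_pos h0
  have hG1 := Real.Gamma_pos_of_pos (sub_pos.2 h1)
  have hd : IntegrableOn (deriv f) (Set.Ioc 0 t) := by
    have := (hf t ht).intervalIntegrable_deriv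
    rwa [intervalIntegrable_iff_integrableOn_Ioc_of_le ht.le] at this
  have hlt : ∀ᵐ u ∂(volume.restrict (Set.Ioc 0 t)), u < t := by
    rw [Measure.restrict_congr_set Ioo_ae_eq_Ioc.symm]
    filter_upwards [ae_restrict_mem measurableSet_Ioo] with u hu using hu.2
  have hint : Integrable (Function.uncurry fun s u => betaKernel ν t s u * deriv f u)
      ((volume : Measure ℝ).prod (volume.restrict (Set.Ioc 0 t))) := by
    rw [integrable_prod_iff']
    · constructor
      · filter_upwards [hlt] with u hu
        exact (integrable_betaKernel h0 h1 hu).mul_const (deriv f u)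
      · refine (hd.norm.const_mul B).congr ?_
        filter_upwards [hlt] with u hu
        simp only [Function.uncurry, norm_mul]
        rw [integral_mul_const]
        simp_rw [Real.norm_of_nonneg (betaKernel_nonneg ν t _ u)]
        rw [integral_betaKernel_left h0 h1 hu]
    · refine Measurable.aestronglyMeasurable ?_
      exact (measurable_betaKernel ν t).mul ((measurable_deriv f).comp measurable_snd)
  -- Integrating over `s` first collapses the kernel to the constant `B`, leaving `B ∫ f'`.
  -- Integrating over `u` first produces the fractional integral of the Caputo derivative.
  have hswap := integral_integral_swap hint
  have hR : ∫ u in Set.Ioc 0 t, ∫ s, betaKernel ν t s u * deriv f u = B * (f t - f 0) := by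
    rw [← hftc, intervalIntegral.integral_of_le ht.le, ← integral_const_mul]
    refine integral_congr_ae ?_
    filter_upwards [hlt] with u hu
    rw [integral_mul_const, integral_betaKernel_left h0 h1 hu]
  have hL : ∫ s, ∫ u in Set.Ioc 0 t, betaKernel ν t s u * deriv f u =
      Real.Gamma (1 - ν) * ∫ s in (0 : ℝ)..t, (t - s) ^ (ν - 1) * g s := by
    rw [intervalIntegral.integral_of_le ht.le]
    have e1 : ∫ s in Set.Ioc 0 t, (t - s) ^ (ν - 1) * g s =
        ∫ s in Set.Ioo 0 t, (t - s) ^ (ν - 1) * caputoDeriv ν f s := by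
      rw [← integral_Ioc_eq_integral_Ioo]
      refine integral_congr_ae ?_
      filter_upwards [hg'] with s hs
      rw [hs]
    rw [e1, ← integral_indicator measurableSet_Ioo, ← integral_const_mul]
    congr 1
    ext s
    by_cases hs : s ∈ Set.Ioo 0 t
    · rw [Set.indicator_of_mem hs, caputoDeriv, if_neg h1.ne,
        intervalIntegral.integral_of_le hs.1.le]
      have : ∫ u in Set.Ioc 0 t, betaKernel ν t s u * deriv f u =
          ∫ u in Set.Ioo 0 s, (t - s) ^ (ν - 1) * ((s - u) ^ (-ν) * deriv f u) := by
        rw [← integral_indicator measurableSet_Ioc, ← integral_indicator measurableSet_Ioo]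
        congr 1
        ext u
        simp only [betaKernel, Set.indicator_apply, Set.mem_Ioc, Set.mem_Ioo]
        have hst := hs.2
        by_cases hu : 0 < u ∧ u < s
        · rw [if_pos ⟨hu.1, (hu.2.trans hst).le⟩, if_pos ⟨hu.2, hst⟩, if_pos hu, mul_assoc]
        · rw [if_neg hu]
          by_cases hu0 : 0 < u
          · rw [if_neg (c := u < s ∧ s < t) (fun h => hu ⟨hu0, h.1⟩)]
            simp
          · rw [if_neg fun h => hu0 h.1]
      rw [this, integral_const_mul, integral_Ioc_eq_integral_Ioo]
      field_simp
    · rw [Set.indicator_of_notMem hs, mul_zero]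
      refine setIntegral_eq_zero_of_forall_eq_zero fun u hu => ?_
      rw [betaKernel, Set.indicator_of_notMem, zero_mul]
      exact fun h => hs ⟨hu.1.trans h.1, h.2⟩
  rw [hL, hR, hB] at hswap
  have h := mul_left_cancel₀ hG1.ne' (hswap.trans (by ring :
    _ = Real.Gamma (1 - ν) * (Real.Gamma ν * (f t - f 0))))
  rw [h, inv_mul_cancel_left₀ hG0.ne']

end Volterra

/-! ### Uniqueness for the fractional Volterra equation, and Laplace transforms -/

section Volterra

theorem integrableOn_rpow_mul_exp {ν z : ℝ} (h0 : 0 < ν) (hz : 0 < z) :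
    IntegrableOn (fun x : ℝ => x ^ (ν - 1) * Real.exp (-(z * x))) (Set.Ioi 0) := by
  refine Integrable.of_integral_ne_zero ?_
  rw [Real.integral_rpow_mul_exp_neg_mul_Ioi h0 hz]
  have := Real.Gamma_pos_of_pos h0
  positivity

theorem intervalIntegrable_fracKernel_exp {ν : ℝ} (h0 : 0 < ν) (z t : ℝ) :
    IntervalIntegrable (fun s => (t - s) ^ (ν - 1) * Real.exp (z * s)) volume 0 t := by
  have h1 : IntervalIntegrable (fun x : ℝ => x ^ (ν - 1)) volume (t - 0) (t - t) :=
    intervalIntegral.intervalIntegrable_rpow' (by linarith)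
  have h2 := (IntervalIntegrable.comp_sub_left h1 t)
  simp only [sub_sub_cancel] at h2
  exact h2.mul_continuousOn (by fun_prop)

/-- Reflecting `s ↦ t - s` pulls out `exp (z t)` and leaves a truncated Gamma integral. The factor
`z^(-ν)` is small for large `z`, so the Volterra operator contracts in the norm weighted by `exp (-z
t)`. -/
theorem integral_fracKernel_exp_le {ν z t : ℝ} (h0 : 0 < ν) (hz : 0 < z) (ht : 0 ≤ t) :
    ∫ s in (0 : ℝ)..t, (t - s) ^ (ν - 1) * Real.exp (z * s) ≤
      Real.exp (z * t) * ((1 / z) ^ ν * Real.Gamma ν) := by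
  have h := intervalIntegral.integral_comp_sub_left (a := 0) (b := t)
    (fun x => x ^ (ν - 1) * Real.exp (z * (t - x))) t
  simp only [sub_sub_cancel, sub_self, sub_zero] at h
  rw [h]
  have h2 : ∀ x : ℝ, x ^ (ν - 1) * Real.exp (z * (t - x)) =
      Real.exp (z * t) * (x ^ (ν - 1) * Real.exp (-(z * x))) := fun x => by
    rw [mul_sub, sub_eq_add_neg (z * t), Real.exp_add]
    ring
  simp_rw [h2]
  rw [intervalIntegral.integral_const_mul, ← Real.integral_rpow_mul_exp_neg_mul_Ioi h0 hz,
    intervalIntegral.integral_of_le ht]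
  refine mul_le_mul_of_nonneg_left ?_ (Real.exp_pos _).le
  refine setIntegral_mono_set (integrableOn_rpow_mul_exp h0 hz) ?_
    (Set.Ioc_subset_Ioi_self.eventuallyLE)
  filter_upwards [ae_restrict_mem measurableSet_Ioi] with x hx
  exact mul_nonneg (Real.rpow_nonneg (le_of_lt hx) _) (Real.exp_pos _).le

/-- A bounded solution of the homogeneous fractional Volterra equation vanishes. -/
theorem eq_zero_of_fracVolterra {ν c C : ℝ} (h0 : 0 < ν) (hc : 0 ≤ c) {q : ℝ → ℝ}
    (hb : ∀ t, |q t| ≤ C)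
    (hq : ∀ t, 0 < t → q t =
      (Real.Gamma ν)⁻¹ * ∫ s in (0 : ℝ)..t, (t - s) ^ (ν - 1) * (-c * q s)) {t : ℝ} (ht : 0 < t) :
    q t = 0 := by
  have hG := Real.Gamma_pos_of_pos h0
  have hC : 0 ≤ C := (abs_nonneg _).trans (hb 0)
  -- With `z^ν = 2c + 1` the operator has weighted norm at most `c / (2c + 1) ≤ 1/2`, so each use of
  -- the equation halves the bound on `q`.
  set z : ℝ := (2 * c + 1) ^ (1 / ν) with hzdef
  have hz : 0 < z := by positivity
  have hzν : (1 / z) ^ ν = 1 / (2 * c + 1) := by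
    rw [Real.div_rpow zero_le_one hz.le, Real.one_rpow, hzdef, ← Real.rpow_mul (by positivity),
      one_div_mul_cancel h0.ne', Real.rpow_one]
  have key : ∀ k : ℕ, ∀ t, 0 < t → |q t| ≤ C * (1 / 2) ^ k * Real.exp (z * t) := by
    intro k
    induction k with
    | zero =>
      intro t ht
      rw [pow_zero, mul_one]
      exact (hb t).trans (le_mul_of_one_le_right hC (Real.one_le_exp (by positivity)))
    | succ k ih =>
      intro t ht
      have h1 : |∫ s in (0 : ℝ)..t, (t - s) ^ (ν - 1) * (-c * q s)| ≤
          ∫ s in (0 : ℝ)..t, (c * (C * (1 / 2) ^ k)) * ((t - s) ^ (ν - 1) * Real.exp (z * s)) := by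
        rw [← Real.norm_eq_abs]
        refine intervalIntegral.norm_integral_le_of_norm_le ht.le ?_
          ((intervalIntegrable_fracKernel_exp h0 z t).const_mul _)
        refine ae_of_all _ fun s hs => ?_
        have hk : 0 ≤ (t - s) ^ (ν - 1) := Real.rpow_nonneg (sub_nonneg.2 hs.2) _
        rw [norm_mul, norm_mul, Real.norm_of_nonneg hk, norm_neg, Real.norm_of_nonneg hc,
          Real.norm_eq_abs]
        calc (t - s) ^ (ν - 1) * (c * |q s|)
            ≤ (t - s) ^ (ν - 1) * (c * (C * (1 / 2) ^ k * Real.exp (z * s))) := by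
              gcongr
              exact ih s hs.1
          _ = _ := by ring
      rw [intervalIntegral.integral_const_mul] at h1
      have h2 := integral_fracKernel_exp_le h0 hz ht.le
      rw [hzν] at h2
      rw [hq t ht, abs_mul, abs_of_pos (inv_pos.2 hG)]
      have hA : 0 ≤ c * (C * (1 / 2) ^ k) := by positivity
      calc (Real.Gamma ν)⁻¹ * |∫ s in (0 : ℝ)..t, (t - s) ^ (ν - 1) * (-c * q s)|
          ≤ (Real.Gamma ν)⁻¹ * ((c * (C * (1 / 2) ^ k)) *
              (Real.exp (z * t) * (1 / (2 * c + 1) * Real.Gamma ν))) := by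
            gcongr
            exact h1.trans (mul_le_mul_of_nonneg_left h2 hA)
        _ = (c / (2 * c + 1)) * (C * (1 / 2) ^ k * Real.exp (z * t)) := by
            field_simp
        _ ≤ (1 / 2) * (C * (1 / 2) ^ k * Real.exp (z * t)) := by
            gcongr ?_ * _
            rw [div_le_div_iff₀ (by positivity) (by norm_num)]
            linarith
        _ = _ := by ring
  have hlim : Tendsto (fun k : ℕ => C * (1 / 2) ^ k * Real.exp (z * t)) atTop (𝓝 0) := by
    have := tendsto_pow_atTop_nhds_zero_of_lt_one (r := (1 / 2 : ℝ)) (by norm_num) (by norm_num)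
    simpa using (this.const_mul C).mul_const (Real.exp (z * t))
  have := ge_of_tendsto' hlim fun k => key k t ht
  exact abs_nonpos_iff.1 this

/-- The fractional integral is a convolution with `x^(ν-1)`. Splitting `exp (-z t)` between the two
factors turns its Laplace transform into a product. -/
theorem integral_exp_mul_fracIntegral {ν z : ℝ} (h0 : 0 < ν) (hz : 0 < z) {h : ℝ → ℝ}
    (hh : IntegrableOn (fun s => Real.exp (-(z * s)) * h s) (Set.Ioi 0)) :
    ∫ t in Set.Ioi (0 : ℝ), Real.exp (-(z * t)) * ∫ s in (0 : ℝ)..t, (t - s) ^ (ν - 1) * h s =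
      ((1 / z) ^ ν * Real.Gamma ν) * ∫ s in Set.Ioi (0 : ℝ), Real.exp (-(z * s)) * h s := by
  have := integral_posConvolution hh (integrableOn_rpow_mul_exp h0 hz)
    (ContinuousLinearMap.mul ℝ ℝ)
  simp only [ContinuousLinearMap.mul_apply'] at this
  rw [Real.integral_rpow_mul_exp_neg_mul_Ioi h0 hz] at this
  rw [mul_comm (_ * _), ← this]
  congr 1
  ext t
  rw [← intervalIntegral.integral_const_mul]
  refine intervalIntegral.integral_congr fun s _ => ?_
  have : Real.exp (-(z * t)) = Real.exp (-(z * s)) * Real.exp (-(z * (t - s))) := by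
    rw [← Real.exp_add]
    ring_nf
  simp only [this]
  ring

theorem integrableOn_exp_mul {z C : ℝ} (hz : 0 < z) {p : ℝ → ℝ}
    (hp : ContinuousOn p (Set.Ici 0)) (hb : ∀ t, |p t| ≤ C) :
    IntegrableOn (fun s => Real.exp (-(z * s)) * p s) (Set.Ioi 0) := by
  have he : IntegrableOn (fun s : ℝ => Real.exp (-(z * s))) (Set.Ioi 0) := by
    simpa using integrableOn_rpow_mul_exp one_pos hz
  refine Integrable.mul_bdd he ?_ (ae_of_all _ hb)
  exact (hp.mono Set.Ioi_subset_Ici_self).aestronglyMeasurable measurableSet_Ioi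

end Volterra

/-! ### State probabilities of a fractional birth process -/

section StateProb

variable {Ω : Type*} [MeasurableSpace Ω] {μ : Measure Ω} {ν : ℝ} {r : ℕ → ℝ}
  {X Y : ℝ≥0 → Ω → ℕ}

theorem stateProb_nonneg (n : ℕ) (t : ℝ) : 0 ≤ stateProb μ X n t := measureReal_nonneg

theorem stateProb_le_one [IsProbabilityMeasure μ] (n : ℕ) (t : ℝ) : stateProb μ X n t ≤ 1 :=
  measureReal_le_one

theorem abs_stateProb_le_one [IsProbabilityMeasure μ] (n : ℕ) (t : ℝ) :
    |stateProb μ X n t| ≤ 1 := by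
  rw [abs_of_nonneg (stateProb_nonneg n t)]
  exact stateProb_le_one n t

namespace IsFractionalBirthProcess

theorem stateProb_zero (h : IsFractionalBirthProcess μ ν r X) (t : ℝ) : stateProb μ X 0 t = 0 := by
  have : {ω | X t.toNNReal ω = 0} = ∅ := by
    ext ω
    have h1 := h.monotone ω (zero_le (a := t.toNNReal))
    have h2 := h.start ω
    simp only [Set.mem_ofPred_eq, Set.mem_empty_iff_false, iff_false]
    simp only at h1
    omega
  rw [stateProb, this, measureReal_empty]

theorem stateProb_at_zero [IsProbabilityMeasure μ] (h : IsFractionalBirthProcess μ ν r X)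
    (n : ℕ) : stateProb μ X n 0 = if n = 1 then 1 else 0 := by
  simp only [stateProb, Real.toNNReal_zero, h.start]
  split_ifs with hn
  · simp [hn]
  · simp [Ne.symm hn]

theorem continuousOn_stateProb (h : IsFractionalBirthProcess μ ν r X) (n : ℕ) :
    ContinuousOn (stateProb μ X n) (Set.Ici 0) := by
  rcases Nat.eq_zero_or_pos n with rfl | hn
  · rw [funext h.stateProb_zero]
    exact continuousOn_const
  · intro t ht
    have h1 := (h.absCont n hn (t + 1) (by linarith [Set.mem_Ici.1 ht])).continuousOn
    rw [Set.uIcc_of_le (by linarith [Set.mem_Ici.1 ht])] at h1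
    refine (h1 t ⟨ht, by linarith⟩).mono_of_mem_nhdsWithin ?_
    rw [← Set.Ici_inter_Iic]
    exact inter_mem self_mem_nhdsWithin
      (mem_nhdsWithin_of_mem_nhds (Iic_mem_nhds (by linarith)))

theorem continuous_stateProb (h : IsFractionalBirthProcess μ ν r X) (n : ℕ) :
    Continuous (stateProb μ X n) := by
  have h1 : Continuous fun t : ℝ => stateProb μ X n (max t 0) :=
    (h.continuousOn_stateProb n).comp_continuous (by fun_prop) fun t => le_max_right t 0
  convert h1 using 2 with t
  have e : (max t 0).toNNReal = t.toNNReal := by simp [Real.toNNReal]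
  rw [stateProb, stateProb, e]

/-- The governing equation enters the proof only through this integral form. -/
theorem stateProb_volterra [IsProbabilityMeasure μ] (h : IsFractionalBirthProcess μ ν r X)
    (h0 : 0 < ν) (h1 : ν ≤ 1) {n : ℕ} (hn : 1 ≤ n) {t : ℝ} (ht : 0 < t) :
    stateProb μ X n t = (if n = 1 then 1 else 0) + (Real.Gamma ν)⁻¹ *
      ∫ s in (0 : ℝ)..t, (t - s) ^ (ν - 1) *
        (- r n * stateProb μ X n s + r (n - 1) * stateProb μ X (n - 1) s) := by
  rw [← sub_eq_fracIntegral_of_caputoDeriv h0 h1 (h.absCont n hn) (h.governing n hn) ht,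
    h.stateProb_at_zero]
  ring

theorem intervalIntegrable_fracKernel_mul {g : ℝ → ℝ} (hg : Continuous g) (h0 : 0 < ν) (t : ℝ) :
    IntervalIntegrable (fun s => (t - s) ^ (ν - 1) * g s) volume 0 t := by
  have := intervalIntegrable_fracKernel_exp h0 0 t
  simp only [zero_mul, Real.exp_zero, mul_one] at this
  exact this.mul_continuousOn hg.continuousOn

/-- The state probabilities are determined by the rates. -/
theorem stateProb_unique [IsProbabilityMeasure μ] (hX : IsFractionalBirthProcess μ ν r X)
    (hY : IsFractionalBirthProcess μ ν r Y) (hr : ∀ n, 0 ≤ r n) (h0 : 0 < ν) (h1 : ν ≤ 1)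
    (n : ℕ) {t : ℝ} (ht : 0 < t) : stateProb μ X n t = stateProb μ Y n t := by
  induction n generalizing t with
  | zero => rw [hX.stateProb_zero, hY.stateProb_zero]
  | succ n ih =>
    -- By induction the source terms from state `n` cancel, so the difference solves the homogeneous
    -- equation with `c = r (n + 1)`. It is bounded by `2`.
    refine sub_eq_zero.1 (eq_zero_of_fracVolterra (C := 2) (c := r (n + 1))
      (q := fun t => stateProb μ X (n + 1) t - stateProb μ Y (n + 1) t) h0 (hr _) ?_ ?_ ht)
    · intro s
      refine (abs_sub _ _).trans ?_
      linarith [abs_stateProb_le_one (μ := μ) (X := X) (n + 1) s,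
        abs_stateProb_le_one (μ := μ) (X := Y) (n + 1) s]
    · intro u hu
      have hcont : ∀ {Z : ℝ≥0 → Ω → ℕ}, IsFractionalBirthProcess μ ν r Z →
          Continuous fun s => - r (n + 1) * stateProb μ Z (n + 1) s +
            r (n + 1 - 1) * stateProb μ Z (n + 1 - 1) s := fun hZ => by
        have := hZ.continuous_stateProb (n + 1)
        have := hZ.continuous_stateProb (n + 1 - 1)
        fun_prop
      rw [hX.stateProb_volterra h0 h1 (Nat.succ_pos n) hu,
        hY.stateProb_volterra h0 h1 (Nat.succ_pos n) hu, add_sub_add_left_eq_sub, ← mul_sub,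
        ← intervalIntegral.integral_sub
          (intervalIntegrable_fracKernel_mul (hcont hX) h0 u)
          (intervalIntegrable_fracKernel_mul (hcont hY) h0 u)]
      congr 1
      refine intervalIntegral.integral_congr_ae (ae_of_all _ fun s hs => ?_)
      rw [Set.uIoc_of_le hu.le] at hs
      simp only [Nat.add_sub_cancel]
      rw [ih hs.1]
      ring

/-- The model does not postulate identically distributed in-link processes; this supplies equality
of their one-time laws. -/
theorem stateProb_eq [IsProbabilityMeasure μ] (hX : IsFractionalBirthProcess μ ν r X)
    (hY : IsFractionalBirthProcess μ ν r Y) (hr : ∀ n, 0 ≤ r n) (h0 : 0 < ν) (h1 : ν ≤ 1)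
    (n : ℕ) : stateProb μ X n = stateProb μ Y n := by
  ext t
  rcases lt_or_ge 0 t with ht | ht
  · exact hX.stateProb_unique hY hr h0 h1 n ht
  · have : ∀ Z : ℝ≥0 → Ω → ℕ, stateProb μ Z n t = stateProb μ Z n 0 := fun Z => by
      simp [stateProb, Real.toNNReal_of_nonpos ht]
    rw [this, this, hX.stateProb_at_zero, hY.stateProb_at_zero]

/-- The law at an independent exponential time of rate `β`. -/
theorem laplace_stateProb [IsProbabilityMeasure μ] (h : IsFractionalBirthProcess μ ν r X)
    (h0 : 0 < ν) (h1 : ν ≤ 1) {β : ℝ} (hβ : 0 < β) {n : ℕ} (hn : 1 ≤ n) :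
    (∫ t in Set.Ioi (0 : ℝ), β * Real.exp (-(β * t)) * stateProb μ X n t) * (1 + r n / β ^ ν) =
      (if n = 1 then 1 else 0) + r (n - 1) / β ^ ν *
        ∫ t in Set.Ioi (0 : ℝ), β * Real.exp (-(β * t)) * stateProb μ X (n - 1) t := by
  have hI : ∀ m, IntegrableOn (fun s => Real.exp (-(β * s)) * stateProb μ X m s) (Set.Ioi 0) :=
    fun m => integrableOn_exp_mul hβ (h.continuousOn_stateProb m) (abs_stateProb_le_one m)
  have hG := Real.Gamma_pos_of_pos h0
  set L : ℕ → ℝ := fun m => ∫ t in Set.Ioi (0 : ℝ), Real.exp (-(β * t)) * stateProb μ X m t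
    with hL
  set δ : ℝ := if n = 1 then 1 else 0 with hδ
  have hexp : IntegrableOn (fun s : ℝ => Real.exp (-(β * s))) (Set.Ioi 0) := by
    simpa using integrableOn_rpow_mul_exp one_pos hβ
  have hexp1 : ∫ s in Set.Ioi (0 : ℝ), Real.exp (-(β * s)) = 1 / β := by
    simpa using Real.integral_rpow_mul_exp_neg_mul_Ioi one_pos hβ
  have hsplit : ∀ s, Real.exp (-(β * s)) *
      (- r n * stateProb μ X n s + r (n - 1) * stateProb μ X (n - 1) s) =
      - r n * (Real.exp (-(β * s)) * stateProb μ X n s) +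
        r (n - 1) * (Real.exp (-(β * s)) * stateProb μ X (n - 1) s) := fun s => by ring
  have hint : IntegrableOn (fun s => Real.exp (-(β * s)) *
      (- r n * stateProb μ X n s + r (n - 1) * stateProb μ X (n - 1) s)) (Set.Ioi 0) := by
    simp_rw [hsplit]
    exact ((hI n).const_mul _).add ((hI (n - 1)).const_mul _)
  have hconv := integral_exp_mul_fracIntegral h0 hβ hint
  simp_rw [hsplit] at hconv
  rw [integral_add ((hI n).const_mul _) ((hI (n - 1)).const_mul _), integral_const_mul,
    integral_const_mul] at hconv
  -- The Volterra equation multiplied by `Γ(ν) exp (-β t)`, ready to be integrated over `t`.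
  have hv : ∀ t ∈ Set.Ioi (0 : ℝ), Real.Gamma ν *
      (Real.exp (-(β * t)) * stateProb μ X n t - δ * Real.exp (-(β * t))) =
      Real.exp (-(β * t)) * ∫ s in (0 : ℝ)..t, (t - s) ^ (ν - 1) *
        (- r n * stateProb μ X n s + r (n - 1) * stateProb μ X (n - 1) s) := by
    intro t ht
    rw [h.stateProb_volterra h0 h1 hn ht, ← hδ]
    field_simp
    ring
  rw [← setIntegral_congr_fun measurableSet_Ioi hv, integral_const_mul,
    integral_sub (hI n) (hexp.const_mul δ), integral_const_mul, hexp1] at hconv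
  simp_rw [mul_assoc β]
  rw [integral_const_mul, integral_const_mul]
  rw [Real.div_rpow zero_le_one hβ.le, Real.one_rpow] at hconv
  have hβν : 0 < β ^ ν := Real.rpow_pos_of_pos hβ ν
  have h2 : L n - δ * (1 / β) = 1 / β ^ ν * (- r n * L n + r (n - 1) * L (n - 1)) := by
    refine mul_left_cancel₀ hG.ne' (hconv.trans ?_)
    ring
  change β * L n * _ = _ + _ * (β * L (n - 1))
  field_simp at h2 ⊢
  linear_combination h2

end IsFractionalBirthProcess

end StateProb

/-! ### The limit law -/

section LimitLaw

/-- The explicit weights of the limit law. -/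
def limitWeight (ρ : ℝ) (N n : ℕ) : ℝ :=
  ((N - 1).choose (N - n) : ℝ) *
    ∑ m ∈ Finset.Icc 1 n, ((n - 1).choose (m - 1) : ℝ) * (-1) ^ (n - m) *
      (1 / (1 + ρ * ((N : ℝ) - (m : ℝ))))

theorem limitWeight_one (ρ : ℝ) (N : ℕ) : limitWeight ρ N 1 = 1 / (1 + ρ * ((N : ℝ) - 1)) := by
  simp [limitWeight]

/-- Write the last denominator as `x i - ρ (k + 1 - i)`. The part without reciprocals is the
expansion of `(1 - 1)^(k+1)`, hence zero. In the rest, `C(k+1, i)(k+1-i) = (k+1) C(k, i)` lowers the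
binomial by one row. -/
theorem limitWeight_succ {ρ : ℝ} (hρ : 0 ≤ ρ) {N n : ℕ} (hn : 1 ≤ n) (hnN : n + 1 ≤ N) :
    limitWeight ρ N (n + 1) * (1 + ρ * ((N : ℝ) - ((n + 1 : ℕ) : ℝ))) =
      ρ * ((N : ℝ) - n) * limitWeight ρ N n := by
  obtain ⟨k, rfl⟩ := Nat.exists_eq_add_of_le' hn
  obtain ⟨j, rfl⟩ := Nat.exists_eq_add_of_le' hnN
  have reindex : ∀ (l : ℕ) (f : ℕ → ℝ),
      ∑ m ∈ Finset.Icc 1 (l + 1), f m = ∑ i ∈ Finset.range (l + 1), f (i + 1) := fun l f => by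
    rw [Finset.range_eq_Ico, Finset.sum_Ico_add' f 0 (l + 1) 1]
    rfl
  -- Here `n = k + 1` and `N = j + k + 2`; `x i` is the denominator of the summand `m = i + 1`.
  set x : ℕ → ℝ := fun i => 1 + ρ * (((j + (k + 1 + 1) : ℕ) : ℝ) - ((i + 1 : ℕ) : ℝ)) with hx
  have hxpos : ∀ i ≤ k + 1, x i ≠ 0 := fun i hi => by
    have : ((i + 1 : ℕ) : ℝ) ≤ ((j + (k + 1 + 1) : ℕ) : ℝ) := by
      exact_mod_cast (by omega)
    have := mul_nonneg hρ (sub_nonneg.2 this)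
    simp only [hx]
    positivity
  have hA : limitWeight ρ (j + (k + 1 + 1)) (k + 1 + 1) = ((j + k + 1).choose j : ℝ) *
      ∑ i ∈ Finset.range (k + 1 + 1), ((k + 1).choose i : ℝ) * (-1) ^ (k + 1 - i) * (1 / x i) := by
    rw [limitWeight, reindex, show j + (k + 1 + 1) - 1 = j + k + 1 by omega,
      show j + (k + 1 + 1) - (k + 1 + 1) = j by omega]
    simp [hx, Nat.add_sub_add_right]
  have hB : limitWeight ρ (j + (k + 1 + 1)) (k + 1) = ((j + k + 1).choose (j + 1) : ℝ) *
      ∑ i ∈ Finset.range (k + 1), (k.choose i : ℝ) * (-1) ^ (k - i) * (1 / x i) := by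
    rw [limitWeight, reindex, show j + (k + 1 + 1) - 1 = j + k + 1 by omega,
      show j + (k + 1 + 1) - (k + 1) = j + 1 by omega]
    simp [hx, Nat.add_sub_add_right]
  have hsum : (∑ i ∈ Finset.range (k + 1 + 1),
      ((k + 1).choose i : ℝ) * (-1) ^ (k + 1 - i) * (1 / x i)) * x (k + 1) =
      ρ * (k + 1) * ∑ i ∈ Finset.range (k + 1), (k.choose i : ℝ) * (-1) ^ (k - i) * (1 / x i) := by
    have halt : ∑ i ∈ Finset.range (k + 1 + 1), ((k + 1).choose i : ℝ) * (-1) ^ (k + 1 - i) = 0 := by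
      have := add_pow (1 : ℝ) (-1) (k + 1)
      rw [add_neg_cancel, zero_pow (Nat.succ_ne_zero k)] at this
      rw [this]
      refine Finset.sum_congr rfl fun i _ => ?_
      rw [one_pow]
      ring
    have hterm : ∀ i ∈ Finset.range (k + 1 + 1),
        ((k + 1).choose i : ℝ) * (-1) ^ (k + 1 - i) * (1 / x i) * x (k + 1) =
        ((k + 1).choose i : ℝ) * (-1) ^ (k + 1 - i) -
        ρ * (((k + 1).choose i : ℝ) * ((k + 1 : ℝ) - i)) * (-1) ^ (k + 1 - i) * (1 / x i) := by
      intro i hi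
      have hi' : i ≤ k + 1 := Nat.lt_succ_iff.1 (Finset.mem_range.1 hi)
      have := hxpos i hi'
      have e : x (k + 1) = x i - ρ * ((k + 1 : ℝ) - i) := by
        simp only [hx]
        push_cast
        ring
      rw [e]
      field_simp
    rw [Finset.sum_mul, Finset.sum_congr rfl hterm, Finset.sum_sub_distrib, halt, zero_sub,
      Finset.sum_range_succ]
    have hlast : ((k + 1 : ℝ) - ((k + 1 : ℕ) : ℝ)) = 0 := by push_cast; ring
    rw [hlast, mul_zero, mul_zero, zero_mul, zero_mul, add_zero, ← Finset.sum_neg_distrib,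
      Finset.mul_sum]
    refine Finset.sum_congr rfl fun i hi => ?_
    have hi' : i ≤ k := Nat.lt_succ_iff.1 (Finset.mem_range.1 hi)
    have hch : ((k + 1).choose i : ℝ) * ((k + 1 : ℝ) - i) = (k + 1 : ℝ) * (k.choose i : ℝ) := by
      have h1 := Nat.choose_mul_succ_eq k i
      have h2 : (((k + 1 - i : ℕ)) : ℝ) = (k + 1 : ℝ) - i := by
        rw [Nat.cast_sub (by omega)]
        push_cast
        ring
      rw [← h2]
      have h3 : ((k.choose i * (k + 1) : ℕ) : ℝ) = (((k + 1).choose i * (k + 1 - i) : ℕ) : ℝ) := by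
        rw [h1]
      push_cast at h3
      rw [← h3]
      ring
    rw [hch, Nat.succ_sub hi', pow_succ]
    ring
  have hchoose : ((j + k + 1).choose j : ℝ) * (k + 1) = ((j + k + 1).choose (j + 1) : ℝ) * (j + 1) := by
    have := Nat.choose_succ_right_eq (j + k + 1) j
    rw [show j + k + 1 - j = k + 1 by omega] at this
    exact_mod_cast this.symm
  have ex : (1 + ρ * (((j + (k + 1 + 1) : ℕ) : ℝ) - ((k + 1 + 1 : ℕ) : ℝ))) = x (k + 1) := rfl
  rw [ex, hA, hB, mul_assoc, hsum]
  have e3 : ((j + (k + 1 + 1) : ℕ) : ℝ) - ((k + 1 : ℕ) : ℝ) = j + 1 := by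
    push_cast
    ring
  rw [e3]
  linear_combination (ρ * ∑ i ∈ Finset.range (k + 1),
    (k.choose i : ℝ) * (-1) ^ (k - i) * (1 / x i)) * hchoose

variable {ρ : ℝ} {N : ℕ} {L : ℕ → ℝ}

theorem eq_limitWeight_of_recursion (hρ : 0 ≤ ρ) (hL0 : L 0 = 0)
    (hrec : ∀ n, 1 ≤ n → L n * (1 + ρ * ((N - n : ℕ) : ℝ)) =
      (if n = 1 then 1 else 0) + ρ * ((N - (n - 1) : ℕ) : ℝ) * L (n - 1))
    {n : ℕ} (hn : 1 ≤ n) (hnN : n ≤ N) : L n = limitWeight ρ N n := by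
  have hpos : ∀ m : ℕ, m ≤ N → 0 < 1 + ρ * ((N : ℝ) - m) := fun m hm => by
    have : (m : ℝ) ≤ N := by exact_mod_cast hm
    have := mul_nonneg hρ (sub_nonneg.2 this)
    positivity
  induction n, hn using Nat.le_induction with
  | base =>
    have h := hrec 1 le_rfl
    have := hpos 1 hnN
    rw [if_pos rfl, Nat.sub_self, hL0, mul_zero, add_zero, Nat.cast_sub hnN] at h
    rw [limitWeight_one, eq_div_iff (by simpa using this.ne')]
    simpa using h
  | succ n hn ih =>
    have h := hrec (n + 1) (by omega)
    rw [if_neg (by omega), Nat.add_sub_cancel, ih (by omega), zero_add, Nat.cast_sub hnN,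
      Nat.cast_sub (by omega), ← limitWeight_succ hρ hn hnN] at h
    exact mul_right_cancel₀ (hpos _ hnN).ne' h

/-- For `n > N` both truncated differences are `0`, and `n ≠ 1` because `N ≥ 1`, so the recursion
reads `L n = 0`. -/
theorem eq_zero_of_recursion (hN : 1 ≤ N)
    (hrec : ∀ n, 1 ≤ n → L n * (1 + ρ * ((N - n : ℕ) : ℝ)) =
      (if n = 1 then 1 else 0) + ρ * ((N - (n - 1) : ℕ) : ℝ) * L (n - 1))
    {n : ℕ} (hn : N < n) : L n = 0 := by
  have h := hrec n (by omega)
  rw [if_neg (by omega), Nat.sub_eq_zero_of_le hn.le, Nat.sub_eq_zero_of_le (by omega)] at h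
  simpa using h

/-- Summing the recursion telescopes: the mass up to `n` plus the outflow `ρ (N - n) L n` is always
`1`, and the outflow vanishes at the absorbing state `N`. -/
theorem sum_eq_one_of_recursion (hN : 1 ≤ N) (hL0 : L 0 = 0)
    (hrec : ∀ n, 1 ≤ n → L n * (1 + ρ * ((N - n : ℕ) : ℝ)) =
      (if n = 1 then 1 else 0) + ρ * ((N - (n - 1) : ℕ) : ℝ) * L (n - 1)) :
    ∑ n ∈ Finset.range (N + 1), L n = 1 := by
  have key : ∀ n, 1 ≤ n →
      ∑ m ∈ Finset.range (n + 1), L m + ρ * ((N - n : ℕ) : ℝ) * L n = 1 := by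
    intro n hn
    induction n, hn using Nat.le_induction with
    | base =>
      have h := hrec 1 le_rfl
      rw [if_pos rfl, Nat.sub_self, hL0, mul_zero, add_zero] at h
      rw [Finset.sum_range_succ, Finset.sum_range_one, hL0]
      linarith
    | succ n hn ih =>
      have h := hrec (n + 1) (by omega)
      rw [if_neg (by omega), Nat.add_sub_cancel] at h
      rw [Finset.sum_range_succ]
      linarith
  simpa using key N hN

theorem exists_probabilityMeasure_of_sum_eq_one (hL : ∀ n, 0 ≤ L n)
    (hsum : ∑ n ∈ Finset.range (N + 1), L n = 1) (hzero : ∀ n, N < n → L n = 0) :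
    ∃ π : ProbabilityMeasure ℕ, ∀ n, (π : Measure ℕ).real {n} = L n := by
  let p : PMF ℕ := PMF.ofFinset (fun n => ENNReal.ofReal (L n)) (Finset.range (N + 1))
    (by rw [← ENNReal.ofReal_sum_of_nonneg fun i _ => hL i, hsum, ENNReal.ofReal_one])
    (fun n hn => by
      rw [Finset.mem_range, not_lt] at hn
      rw [hzero n hn, ENNReal.ofReal_zero])
  refine ⟨⟨p.toMeasure, inferInstance⟩, fun n => ?_⟩
  change p.toMeasure.real {n} = L n
  rw [measureReal_def, PMF.toMeasure_apply_singleton p n (measurableSet_singleton n)]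
  exact ENNReal.toReal_ofReal (hL n)

end LimitLaw

/-! ### Empirical ages in a deterministic sequence of creation times -/

section Empirical

/-- An average over a growing index set becomes an integral over the fixed interval `[0, 1]`, where
dominated convergence applies. -/
theorem integral_comp_floor_mul (a : ℕ → ℝ) {n : ℕ} (hn : 0 < n) :
    ∫ u in (0 : ℝ)..1, a ⌊u * n⌋₊ = (n : ℝ)⁻¹ * ∑ k ∈ Finset.range n, a k := by
  have hn' : (n : ℝ) ≠ 0 := by positivity
  have h1 := intervalIntegral.integral_comp_mul_right (a := 0) (b := 1)
    (fun v : ℝ => a ⌊v⌋₊) hn'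
  rw [h1, zero_mul, one_mul, smul_eq_mul]
  congr 1
  have hae : ∀ k : ℕ, ∀ᵐ v : ℝ, v ∈ Set.uIoc (k : ℝ) ((k + 1 : ℕ) : ℝ) → a ⌊v⌋₊ = a k := by
    intro k
    have : ∀ᵐ v : ℝ, v ≠ ((k + 1 : ℕ) : ℝ) := by
      simp [ae_iff]
    filter_upwards [this] with v hv hv'
    rw [Set.uIoc_of_le (by simp)] at hv'
    have : ⌊v⌋₊ = k := by
      rw [Nat.floor_eq_iff (le_trans (Nat.cast_nonneg k) hv'.1.le)]
      refine ⟨hv'.1.le, ?_⟩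
      have := lt_of_le_of_ne hv'.2 hv
      exact_mod_cast this
    rw [this]
  have hcongr : ∀ k : ℕ, ∫ v in (k : ℝ)..((k + 1 : ℕ) : ℝ), a ⌊v⌋₊ = a k := fun k => by
    rw [intervalIntegral.integral_congr_ae (hae k), intervalIntegral.integral_const]
    simp
  have hint : ∀ k < n, IntervalIntegrable (fun v : ℝ => a ⌊v⌋₊) volume (k : ℝ) ((k + 1 : ℕ) : ℝ) := by
    intro k _
    refine (intervalIntegrable_const (c := a k)).congr_ae ?_
    rw [Filter.EventuallyEq, ae_restrict_iff' measurableSet_uIoc]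
    filter_upwards [hae k] with v hv hv'
    exact (hv hv').symm
  have h2 := intervalIntegral.sum_integral_adjacent_intervals (a := fun k : ℕ => (k : ℝ)) hint
  simp only [hcongr, Nat.cast_zero] at h2
  exact h2.symm

/-- Substitute `u = exp (-β s)`: for uniform `u`, `-log u / β` is exponential of rate `β`. -/
theorem integral_comp_neg_log_div {β : ℝ} (hβ : 0 < β) (g : ℝ → ℝ) :
    ∫ u in (0 : ℝ)..1, g (-(Real.log u) / β) =
      ∫ s in Set.Ioi (0 : ℝ), β * Real.exp (-(β * s)) * g s := by
  have himg : (fun s : ℝ => Real.exp (-(β * s))) '' Set.Ioi 0 = Set.Ioo 0 1 := by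
    ext u
    constructor
    · rintro ⟨s, hs, rfl⟩
      exact ⟨Real.exp_pos _, by
        rw [← Real.exp_zero]
        exact Real.exp_lt_exp.2 (neg_lt_zero.2 (mul_pos hβ hs))⟩
    · rintro ⟨h0, h1⟩
      refine ⟨-(Real.log u) / β, div_pos (neg_pos.2 (Real.log_neg h0 h1)) hβ, ?_⟩
      simp only
      rw [mul_div_cancel₀ _ hβ.ne', neg_neg, Real.exp_log h0]
  have hd : ∀ s ∈ Set.Ioi (0 : ℝ), HasDerivWithinAt (fun s : ℝ => Real.exp (-(β * s)))
      (Real.exp (-(β * s)) * (-β)) (Set.Ioi 0) s := by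
    intro s _
    have h1 : HasDerivAt (fun s : ℝ => -(β * s)) (-β) s := by
      simpa using ((hasDerivAt_id' s).const_mul β).fun_neg
    exact h1.exp.hasDerivWithinAt
  have hinj : Set.InjOn (fun s : ℝ => Real.exp (-(β * s))) (Set.Ioi 0) := by
    intro s _ s' _ h
    have := Real.exp_injective h
    exact mul_left_cancel₀ hβ.ne' (neg_injective this)
  have h := integral_image_eq_integral_abs_deriv_smul measurableSet_Ioi hd hinj
    (fun u => g (-(Real.log u) / β))
  rw [himg] at h
  rw [intervalIntegral.integral_of_le zero_le_one, integral_Ioc_eq_integral_Ioo, h]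
  refine setIntegral_congr_fun measurableSet_Ioi fun s _ => ?_
  simp only [Real.log_exp, neg_neg, mul_div_cancel_left₀ s hβ.ne', abs_mul, abs_neg,
    abs_of_pos hβ, abs_of_pos (Real.exp_pos _), smul_eq_mul]
  ring

variable {T : ℕ → ℝ} {β c : ℝ}

theorem tendsto_floor_sub_log (hT : Tendsto (fun k : ℕ => T k - Real.log (k + 1) / β) atTop (𝓝 c))
    {u : ℝ} (hu : 0 < u) :
    Tendsto (fun n : ℕ => T ⌊u * n⌋₊ - Real.log n / β) atTop (𝓝 (c + Real.log u / β)) := by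
  have hfl : Tendsto (fun n : ℕ => ⌊u * (n : ℝ)⌋₊) atTop atTop :=
    tendsto_nat_floor_atTop.comp
      (Tendsto.const_mul_atTop hu tendsto_natCast_atTop_atTop)
  have h1 := hT.comp hfl
  have h2 : Tendsto (fun n : ℕ => ((⌊u * (n : ℝ)⌋₊ : ℝ) + 1) / n) atTop (𝓝 u) := by
    have h3 := (tendsto_nat_floor_mul_div_atTop (R := ℝ) hu.le).comp
      (tendsto_natCast_atTop_atTop (R := ℝ))
    have h4 := h3.add (tendsto_one_div_atTop_nhds_zero_nat (𝕜 := ℝ))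
    rw [add_zero] at h4
    refine h4.congr fun n => ?_
    simp only [Function.comp]
    rw [add_div]
  have h5 := h1.add (((Real.continuousAt_log hu.ne').tendsto.comp h2).div_const β)
  refine h5.congr' ?_
  filter_upwards [eventually_gt_atTop 0] with n hn
  have hn' : (n : ℝ) ≠ 0 := by positivity
  simp only [Function.comp]
  rw [Real.log_div (by positivity) hn']
  ring

theorem tendsto_atTop_of_sub_log (hβ : 0 < β)
    (hT : Tendsto (fun k : ℕ => T k - Real.log (k + 1) / β) atTop (𝓝 c)) :
    Tendsto T atTop atTop := by
  have h1 : Tendsto (fun k : ℕ => Real.log ((k : ℝ) + 1) / β) atTop atTop :=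
    (Real.tendsto_log_atTop.comp
      (tendsto_atTop_add_const_right _ 1 tendsto_natCast_atTop_atTop)).atTop_div_const hβ
  refine (hT.add_atTop h1).congr fun k => ?_
  ring

/-- The pages present form a finite initial segment, so their number determines which they are. -/
theorem exists_setOf_le_eq_Iio (hmono : Monotone T) (htop : Tendsto T atTop atTop) (t : ℝ) :
    {k | T k ≤ t} = Set.Iio ({k | T k ≤ t}.ncard) := by
  obtain ⟨n, hn⟩ : ∃ n, ∀ k, T k ≤ t ↔ k < n := by
    classical
    have hex : ∃ k, t < T k := (htop.eventually_gt_atTop t).exists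
    refine ⟨Nat.find hex, fun k => ⟨fun hk => ?_, fun hk => ?_⟩⟩
    · by_contra h
      exact absurd (hmono (not_lt.1 h)) (not_le.2 (hk.trans_lt (Nat.find_spec hex)))
    · exact not_lt.1 (Nat.find_min hex hk)
  have : {k | T k ≤ t} = Set.Iio n := by
    ext k
    exact hn k
  rw [this]
  congr 1
  rw [← Finset.coe_Iio, Set.ncard_coe_finset, Nat.card_Iio]

/-- The average of a bounded continuous function over the ages at time `t` converges to its
exponential average. -/
theorem tendsto_average_ages (hβ : 0 < β) (hmono : Monotone T)
    (hT : Tendsto (fun k : ℕ => T k - Real.log (k + 1) / β) atTop (𝓝 c))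
    {g : ℝ → ℝ} (hg : Continuous g) {C : ℝ} (hC : ∀ s, |g s| ≤ C) :
    Tendsto (fun t : ℝ => ({k | T k ≤ t}.ncard : ℝ)⁻¹ *
        ∑ k ∈ Finset.range ({k | T k ≤ t}.ncard), g (t - T k)) atTop
      (𝓝 (∫ s in Set.Ioi (0 : ℝ), β * Real.exp (-(β * s)) * g s)) := by
  have htop := tendsto_atTop_of_sub_log hβ hT
  set n : ℝ → ℕ := fun t => {k | T k ≤ t}.ncard with hn
  have hiff : ∀ t k, T k ≤ t ↔ k < n t := fun t k => by
    have := exists_setOf_le_eq_Iio hmono htop t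
    exact Set.ext_iff.1 this k
  have hntop : Tendsto n atTop atTop := by
    refine tendsto_atTop.2 fun m => ?_
    filter_upwards [eventually_ge_atTop (T m)] with t ht
    exact ((hiff t m).1 ht).le
  have hpos : ∀ᶠ t in atTop, 0 < n t := hntop.eventually_gt_atTop 0
  -- Squeeze `t` between `T (n t - 1)` and `T (n t)`.
  have hlog : Tendsto (fun t => t - Real.log (n t) / β) atTop (𝓝 c) := by
    have hup : Tendsto (fun m : ℕ => T m - Real.log m / β) atTop (𝓝 c) := by
      simpa using tendsto_floor_sub_log hT one_pos
    have hlow : Tendsto (fun m : ℕ => T (m - 1) - Real.log m / β) atTop (𝓝 c) := by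
      refine (hT.comp (tendsto_sub_atTop_nat 1)).congr' ?_
      filter_upwards [eventually_gt_atTop 0] with m hm
      simp only [Function.comp]
      have : ((m - 1 : ℕ) : ℝ) + 1 = m := by
        rw [Nat.cast_sub hm]
        push_cast
        ring
      rw [this]
    refine tendsto_of_tendsto_of_tendsto_of_le_of_le' (hlow.comp hntop) (hup.comp hntop) ?_ ?_
    · filter_upwards [hpos] with t ht
      have := (hiff t (n t - 1)).2 (Nat.sub_lt ht one_pos)
      simpa using this
    · filter_upwards with t
      have : t < T (n t) := lt_of_not_ge fun h => lt_irrefl _ ((hiff t (n t)).1 h)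
      simpa using this.le
  rw [← integral_comp_neg_log_div hβ]
  have hmain : Tendsto (fun t : ℝ => ∫ u in (0 : ℝ)..1, g (t - T ⌊u * n t⌋₊)) atTop
      (𝓝 (∫ u in (0 : ℝ)..1, g (-(Real.log u) / β))) := by
    refine intervalIntegral.tendsto_integral_filter_of_dominated_convergence (fun _ => C) ?_ ?_
      intervalIntegrable_const ?_
    · refine Eventually.of_forall fun t => Measurable.aestronglyMeasurable ?_
      have : Measurable fun u : ℝ => T ⌊u * n t⌋₊ :=
        (measurable_of_countable T).comp (Nat.measurable_floor.comp (measurable_id.mul_const _))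
      exact hg.measurable.comp (measurable_const.sub this)
    · exact Eventually.of_forall fun t => ae_of_all _ fun u _ => hC _
    · refine ae_of_all _ fun u hu => ?_
      rw [Set.uIoc_of_le zero_le_one] at hu
      have h1 := (tendsto_floor_sub_log hT hu.1).comp hntop
      have h2 := hlog.sub h1
      -- The path-dependent constant `c` cancels, so the limiting age law is deterministic.
      have h3 : c - (c + Real.log u / β) = -(Real.log u) / β := by ring
      rw [h3] at h2
      refine (hg.tendsto _).comp (h2.congr fun t => ?_)
      simp only [Function.comp]
      ring
  refine hmain.congr' ?_
  filter_upwards [hpos] with t ht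
  exact integral_comp_floor_mul (fun k => g (t - T k)) ht

end Empirical

/-! ### Almost sure growth of the Yule process -/

section Series

variable {Ω : Type*} [MeasurableSpace Ω] {μ : Measure Ω}

/-- A series of independent centred square-integrable random variables with summable variances
converges almost surely. -/
theorem ae_exists_tendsto_sum_of_summable_variance [IsProbabilityMeasure μ] {X : ℕ → Ω → ℝ}
    (hm : ∀ i, Measurable (X i)) (hL2 : ∀ i, MemLp (X i) 2 μ) (hind : iIndepFun X μ)
    (hmean : ∀ i, ∫ ω, X i ω ∂μ = 0) (hvar : Summable fun i => variance (X i) μ) :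
    ∀ᵐ ω ∂μ, ∃ c, Tendsto (fun n => ∑ i ∈ Finset.range n, X i ω) atTop (𝓝 c) := by
  have hsm : ∀ i, StronglyMeasurable (X i) := fun i => (hm i).stronglyMeasurable
  have hint : ∀ i, Integrable (X i) μ := fun i => (hL2 i).integrable (by norm_num)
  set 𝒢 := Filtration.natural X hsm with h𝒢
  -- The sum includes `X n`, matching the natural filtration at time `n`.
  set S : ℕ → Ω → ℝ := fun n => ∑ i ∈ Finset.range (n + 1), X i with hS
  have hSint : ∀ n, Integrable (S n) μ := fun n => integrable_finsetSum' _ fun i _ => hint i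
  have hSL2 : ∀ n, MemLp (S n) 2 μ := fun n => memLp_finsetSum' _ fun i _ => hL2 i
  have hadapt : StronglyAdapted 𝒢 S := by
    intro n
    refine Finset.stronglyMeasurable_sum _ fun i hi => ?_
    exact (Filtration.stronglyAdapted_natural hsm i).mono
      (𝒢.mono (Nat.lt_succ_iff.1 (Finset.mem_range.1 hi)))
  have hmart : Martingale S 𝒢 μ := by
    refine martingale_of_condExp_sub_eq_zero_nat hadapt hSint fun n => ?_
    have e : S (n + 1) - S n = X (n + 1) := by
      simp only [hS]
      rw [Finset.sum_range_succ _ (n + 1)]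
      simp
    rw [e]
    have h1 := hind.condExp_natural_ae_eq_of_lt hsm (Nat.lt_succ_self n)
    filter_upwards [h1] with ω hω
    rw [hω, hmean]
    rfl
  have hSmean : ∀ n, ∫ ω, S n ω ∂μ = 0 := by
    intro n
    simp only [hS, Finset.sum_apply]
    rw [integral_finsetSum _ fun i _ => hint i]
    simp [hmean]
  have hvarS : ∀ n, variance (S n) μ ≤ ∑' i, variance (X i) μ := by
    intro n
    rw [hS, IndepFun.variance_sum (fun i _ => hL2 i) fun i _ j _ hij => hind.indepFun hij]
    exact hvar.sum_le_tsum _ fun i _ => variance_nonneg _ _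
  -- From `|s| ≤ 1 + s²` and the bounded variances: an `L¹` bound for martingale convergence.
  set R : ℝ≥0 := (1 + ∑' i, variance (X i) μ).toNNReal with hR
  have hbdd : ∀ n, eLpNorm (S n) 1 μ ≤ R := by
    intro n
    rw [eLpNorm_one_eq_lintegral_enorm, ← ofReal_integral_norm_eq_lintegral_enorm (hSint n)]
    refine ENNReal.ofReal_le_ofReal ?_
    have h2 : Integrable (fun ω => 1 + S n ω ^ 2) μ :=
      (integrable_const 1).add (hSL2 n).integrable_sq
    have h3 : ∫ ω, ‖S n ω‖ ∂μ ≤ ∫ ω, 1 + S n ω ^ 2 ∂μ := by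
      refine integral_mono (hSint n).norm h2 fun ω => ?_
      simp only [Real.norm_eq_abs]
      nlinarith [sq_abs (S n ω), sq_nonneg (|S n ω| - 1), sq_nonneg (|S n ω|)]
    have h4 := variance_of_integral_eq_zero (hSint n).aemeasurable (hSmean n)
    rw [integral_add (integrable_const 1) (hSL2 n).integrable_sq] at h3
    simp only [integral_const, probReal_univ, smul_eq_mul, mul_one] at h3
    have h5 := hvarS n
    rw [h4] at h5
    linarith
  filter_upwards [hmart.submartingale.exists_ae_tendsto_of_bdd hbdd] with ω ⟨c, hc⟩
  refine ⟨c, (tendsto_add_atTop_iff_nat 1).1 (hc.congr fun n => ?_)⟩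
  simp [hS]

end Series

/-! ### Moments of the exponential law -/

section Exponential

theorem integral_expMeasure {r : ℝ} (hr : 0 < r) (g : ℝ → ℝ) :
    ∫ x, g x ∂(expMeasure r) = ∫ x in Set.Ioi (0 : ℝ), r * Real.exp (-(r * x)) * g x := by
  have h1 : expMeasure r = volume.withDensity (exponentialPDF r) := rfl
  have hmeas : Measurable (exponentialPDF r) :=
    ENNReal.measurable_ofReal.comp (measurable_exponentialPDFReal r)
  rw [h1, integral_withDensity_eq_integral_toReal_smul hmeas
    (ae_of_all _ fun x => ENNReal.ofReal_lt_top), ← integral_Ici_eq_integral_Ioi,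
    ← integral_indicator measurableSet_Ici]
  congr 1
  ext x
  by_cases hx : 0 ≤ x
  · rw [Set.indicator_of_mem (Set.mem_Ici.2 hx), exponentialPDF_of_nonneg hx,
      ENNReal.toReal_ofReal (by positivity), smul_eq_mul]
  · rw [Set.indicator_of_notMem (show x ∉ Set.Ici (0 : ℝ) from hx), exponentialPDF_of_neg (not_le.1 hx)]
    simp

theorem integral_id_expMeasure {r : ℝ} (hr : 0 < r) : ∫ x, x ∂(expMeasure r) = 1 / r := by
  have h := Real.integral_rpow_mul_exp_neg_mul_Ioi (a := 2) (by norm_num) hr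
  rw [integral_expMeasure hr]
  have e : ∀ x : ℝ, r * Real.exp (-(r * x)) * x =
      r * (x ^ ((2 : ℝ) - 1) * Real.exp (-(r * x))) := fun x => by
    rw [show (2 : ℝ) - 1 = 1 by norm_num, Real.rpow_one]
    ring
  simp_rw [e]
  rw [integral_const_mul, h, Real.Gamma_two, Real.rpow_two]
  field_simp

theorem integral_sq_expMeasure {r : ℝ} (hr : 0 < r) : ∫ x, x ^ 2 ∂(expMeasure r) = 2 / r ^ 2 := by
  have h := Real.integral_rpow_mul_exp_neg_mul_Ioi (a := 3) (by norm_num) hr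
  rw [integral_expMeasure hr]
  have e : ∀ x : ℝ, r * Real.exp (-(r * x)) * x ^ 2 =
      r * (x ^ ((3 : ℝ) - 1) * Real.exp (-(r * x))) := fun x => by
    rw [show (3 : ℝ) - 1 = 2 by norm_num, Real.rpow_two]
    ring
  have hG : Real.Gamma 3 = 2 := by
    rw [show (3 : ℝ) = ((2 : ℕ) : ℝ) + 1 by norm_num, Real.Gamma_nat_eq_factorial]
    norm_num
  simp_rw [e]
  rw [integral_const_mul, h, hG, show (3 : ℝ) = ((3 : ℕ) : ℝ) by norm_num, Real.rpow_natCast]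
  field_simp

theorem ae_pos_expMeasure {r : ℝ} (hr : 0 < r) : ∀ᵐ x ∂(expMeasure r), 0 < x := by
  have := isProbabilityMeasure_expMeasure hr
  have h := cdf_expMeasure_eq hr 0
  rw [cdf_eq_real, if_pos le_rfl, mul_zero, neg_zero, Real.exp_zero, sub_self,
    measureReal_eq_zero_iff] at h
  rw [ae_iff]
  convert h using 2
  ext x
  simp

end Exponential

/-! ### Logarithmic growth of the creation times -/

section Yule

variable {Ω : Type*} [MeasurableSpace Ω] {μ : Measure Ω} {β : ℝ}
  {W : ℕ → Ω → ℝ}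

theorem ae_monotone_creationTime (hβ : 0 < β)
    (hlaw : ∀ i : ℕ, HasLaw (W i) (expMeasure (β * (i + 1))) μ) :
    ∀ᵐ ω ∂μ, Monotone fun k => creationTime W k ω := by
  have h : ∀ i, ∀ᵐ ω ∂μ, 0 < W i ω := fun i => by
    refine ae_of_ae_map (hlaw i).aemeasurable ?_
    rw [(hlaw i).map_eq]
    exact ae_pos_expMeasure (by positivity)
  filter_upwards [ae_all_iff.2 h] with ω hω
  refine monotone_nat_of_le_succ fun k => ?_
  rw [creationTime, creationTime, Finset.sum_range_succ]
  linarith [hω k]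

/-- The means `1 / (β (i + 1))` sum to `H_k / β`, and `H_k - log (k + 1)` tends to Euler's constant.
The variances are of order `1 / (i + 1)²`, so the centred sums converge almost surely. -/
theorem ae_exists_tendsto_creationTime_sub_log [IsProbabilityMeasure μ] (hβ : 0 < β) (hm : ∀ i, Measurable (W i))
    (hlaw : ∀ i : ℕ, HasLaw (W i) (expMeasure (β * (i + 1))) μ) (hind : iIndepFun W μ) :
    ∀ᵐ ω ∂μ, ∃ c,
      Tendsto (fun k : ℕ => creationTime W k ω - Real.log (k + 1) / β) atTop (𝓝 c) := by
  have hrate : ∀ i : ℕ, 0 < β * ((i : ℝ) + 1) := fun i => by positivity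
  have hsq : ∀ i, ∫ ω, W i ω ^ 2 ∂μ = 2 / (β * (i + 1)) ^ 2 := fun i => by
    rw [← integral_sq_expMeasure (hrate i)]
    exact (hlaw i).integral_comp (f := fun x => x ^ 2) (by fun_prop)
  have hL2 : ∀ i, MemLp (W i) 2 μ := fun i => by
    rw [memLp_two_iff_integrable_sq (hm i).aestronglyMeasurable]
    refine Integrable.of_integral_ne_zero ?_
    rw [hsq]
    have := hrate i
    positivity
  have hmean : ∀ i, ∫ ω, W i ω ∂μ = 1 / (β * (i + 1)) := fun i => by
    rw [← integral_id_expMeasure (hrate i)]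
    exact (hlaw i).integral_eq
  have hconv := ae_exists_tendsto_sum_of_summable_variance
    (X := fun i ω => W i ω - 1 / (β * (i + 1))) (μ := μ)
    (fun i => (hm i).sub_const _) (fun i => (hL2 i).sub (memLp_const _))
    (hind.comp (fun i x => x - 1 / (β * ((i : ℝ) + 1))) fun i => measurable_id.sub_const _)
    (fun i => by
      rw [integral_sub ((hL2 i).integrable (by norm_num)) (integrable_const _), hmean]
      simp) ?_
  · filter_upwards [hconv] with ω ⟨c, hc⟩
    refine ⟨c + Real.eulerMascheroniConstant / β, ?_⟩
    refine (hc.add (Real.tendsto_harmonic_sub_log_add_one.div_const β)).congr fun k => ?_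
    have hh : ∑ i ∈ Finset.range k, 1 / (β * ((i : ℝ) + 1)) = (harmonic k : ℝ) / β := by
      rw [harmonic]
      push_cast
      rw [Finset.sum_div]
      refine Finset.sum_congr rfl fun i _ => ?_
      field_simp
    rw [Finset.sum_sub_distrib, hh, creationTime]
    ring
  · refine Summable.of_nonneg_of_le (fun i => variance_nonneg _ _)
      (f := fun i : ℕ => 2 / β ^ 2 * (1 / ((i : ℝ) + 1) ^ 2)) (fun i => ?_) ?_
    · rw [variance_sub_const (hm i).aestronglyMeasurable]
      refine (variance_le_expectation_sq (hm i).aestronglyMeasurable).trans (le_of_eq ?_)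
      change ∫ ω, W i ω ^ 2 ∂μ = _
      rw [hsq]
      field_simp
    · refine Summable.mul_left _ ?_
      have := (summable_nat_add_iff 1).2 (Real.summable_one_div_nat_pow.2 one_lt_two)
      simpa using this

end Yule

/-! ### Evaluating a right-continuous process at an independent random time -/

section RandomTime

variable {Ω : Type*}

/-- The approximation of `s` from the right by multiples of `1 / (j + 1)`. -/
def gridAbove (j : ℕ) (i : ℕ) : ℝ≥0 := (i + 1) / (j + 1)

/-- The paths are only right-continuous, so the approximation must come from the right. Its
countably many values reduce random times to deterministic ones. -/
theorem tendsto_gridAbove (s : ℝ≥0) :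
    Tendsto (fun j : ℕ => gridAbove j ⌊s * (j + 1)⌋₊) atTop (𝓝[≥] s) := by
  refine tendsto_nhdsWithin_iff.2 ⟨?_, Eventually.of_forall fun j => ?_⟩
  · have h1 : Tendsto (fun j : ℕ => s + 1 / ((j : ℝ≥0) + 1)) atTop (𝓝 (s + 0)) :=
      tendsto_const_nhds.add tendsto_one_div_add_atTop_nhds_zero_nat
    rw [add_zero] at h1
    refine tendsto_of_tendsto_of_tendsto_of_le_of_le tendsto_const_nhds h1 (fun j => ?_)
      fun j => ?_
    · simp only [gridAbove]
      rw [le_div_iff₀ (by positivity)]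
      exact (Nat.lt_floor_add_one _).le
    · simp only [gridAbove]
      rw [div_le_iff₀ (by positivity), add_mul, one_div, inv_mul_cancel₀ (by positivity)]
      gcongr
      exact Nat.floor_le (zero_le)
  · simp only [gridAbove, Set.mem_Ici]
    rw [le_div_iff₀ (by positivity)]
    exact (Nat.lt_floor_add_one _).le

theorem tendsto_comp_gridAbove {X : ℝ≥0 → Ω → ℕ}
    (hX : ∀ ω t, ContinuousWithinAt (fun s => X s ω) (Set.Ici t) t) (s : ℝ≥0) (ω : Ω) :
    Tendsto (fun j : ℕ => X (gridAbove j ⌊s * (j + 1)⌋₊) ω) atTop (𝓝 (X s ω)) :=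
  (hX ω s).tendsto.comp (tendsto_gridAbove s)

theorem measurable_comp_nat [MeasurableSpace Ω] {X : ℝ≥0 → Ω → ℕ} (hX : ∀ s, Measurable (X s))
    {κ : Ω → ℕ} (hκ : Measurable κ) (c : ℕ → ℝ≥0) : Measurable fun ω => X (c (κ ω)) ω := by
  have : Measurable fun p : ℕ × Ω => X (c p.1) p.2 :=
    measurable_from_prod_countable_right fun i => hX (c i)
  exact this.comp (hκ.prodMk measurable_id)

theorem measurable_floor_mul [MeasurableSpace Ω] {s : Ω → ℝ≥0} (hs : Measurable s) (j : ℕ) :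
    Measurable fun ω => ⌊s ω * (j + 1)⌋₊ :=
  Nat.measurable_floor.comp (hs.mul_const _)

theorem measurable_comp_age [MeasurableSpace Ω] {X : ℝ≥0 → Ω → ℕ} (hX : ∀ s, Measurable (X s))
    (hrc : ∀ ω t, ContinuousWithinAt (fun s => X s ω) (Set.Ici t) t)
    {s : Ω → ℝ≥0} (hs : Measurable s) : Measurable fun ω => X (s ω) ω := by
  refine measurable_of_tendsto_metrizable
    (fun j : ℕ => measurable_comp_nat hX (measurable_floor_mul hs j) (gridAbove j)) ?_
  exact tendsto_pi_nhds.2 fun ω => tendsto_comp_gridAbove hrc (s ω) ω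

theorem hasSum_setIntegral_fiber [MeasurableSpace Ω] {μ : Measure Ω} {f : Ω → ℝ}
    (hf : Integrable f μ) {κ : Ω → ℕ} (hκ : Measurable κ) :
    HasSum (fun i => ∫ ω in κ ⁻¹' {i}, f ω ∂μ) (∫ ω, f ω ∂μ) := by
  have h := hasSum_integral_iUnion (μ := μ) (f := f) (s := fun i : ℕ => κ ⁻¹' {i})
    (fun i => hκ (measurableSet_singleton i))
    (fun i j hij => Disjoint.preimage κ (Set.disjoint_singleton.2 hij)) hf.integrableOn
  have hU : (⋃ i : ℕ, κ ⁻¹' {i}) = Set.univ := by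
    ext ω
    simp
  rwa [hU, setIntegral_univ] at h

/-- The indicator function of the state `n`. -/
def stateInd (n m : ℕ) : ℝ := if m = n then 1 else 0

theorem abs_stateInd_le_one (n m : ℕ) : |stateInd n m| ≤ 1 := by
  unfold stateInd
  split_ifs <;> simp

theorem integral_stateInd_comp [MeasurableSpace Ω] {μ : Measure Ω} {Y : Ω → ℕ}
    (hY : Measurable Y) (n : ℕ) : ∫ ω, stateInd n (Y ω) ∂μ = μ.real {ω | Y ω = n} := by
  have : (fun ω => stateInd n (Y ω)) = Set.indicator {ω | Y ω = n} 1 := by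
    ext ω
    simp [stateInd, Set.indicator_apply]
  rw [this, integral_indicator_one]
  exact hY (measurableSet_singleton n)

variable {mF mG : MeasurableSpace Ω} [mΩ : MeasurableSpace Ω] {μ : Measure Ω}
  [IsProbabilityMeasure μ] {X : ℝ≥0 → Ω → ℕ} {h : Ω → ℝ} {C : ℝ}

theorem integrable_stateInd_mul (hh : Measurable h) (hC : ∀ ω, |h ω| ≤ C) {Y : Ω → ℕ}
    (hY : Measurable Y) (n : ℕ) : Integrable (fun ω => stateInd n (Y ω) * h ω) μ := by
  refine Integrable.bdd_mul (c := 1) (Integrable.of_bound hh.aestronglyMeasurable C (ae_of_all _ hC))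
    ((measurable_of_countable (stateInd n)).comp hY).aestronglyMeasurable
    (ae_of_all _ fun ω => abs_stateInd_le_one _ _)

/-- Split according to the value of `κ`: on each piece the time is deterministic, and independence
factors the integral. -/
theorem integral_stateInd_comp_nat_mul (hF : mF ≤ mΩ) (hG : mG ≤ mΩ) (hind : Indep mF mG μ)
    (hX : ∀ s, Measurable[mG] (X s)) (hh : Measurable[mF] h) (hC : ∀ ω, |h ω| ≤ C)
    {κ : Ω → ℕ} (hκ : Measurable[mF] κ) (c : ℕ → ℝ≥0) (n : ℕ) :
    ∫ ω, stateInd n (X (c (κ ω)) ω) * h ω ∂μ =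
      ∫ ω, μ.real {ω' | X (c (κ ω)) ω' = n} * h ω ∂μ := by
  have hXm : ∀ s, Measurable (X s) := fun s => (hX s).mono hG le_rfl
  have hhm : Measurable h := hh.mono hF le_rfl
  have hκm : Measurable κ := hκ.mono hF le_rfl
  have hI1 := integrable_stateInd_mul (μ := μ) hhm hC (measurable_comp_nat hXm hκm c) n
  have hI2 : Integrable (fun ω => μ.real {ω' | X (c (κ ω)) ω' = n} * h ω) μ := by
    refine Integrable.bdd_mul (c := 1)
      (Integrable.of_bound hhm.aestronglyMeasurable C (ae_of_all _ hC)) ?_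
      (ae_of_all _ fun ω => ?_)
    · exact ((measurable_of_countable fun i => μ.real {ω' | X (c i) ω' = n}).comp
        hκm).aestronglyMeasurable
    · rw [Real.norm_of_nonneg measureReal_nonneg]
      exact measureReal_le_one
  refine (hasSum_setIntegral_fiber hI1 hκm).unique ?_
  convert hasSum_setIntegral_fiber hI2 hκm using 2 with i
  have hmi : MeasurableSet (κ ⁻¹' {i}) := hκm (measurableSet_singleton i)
  have e1 : ∫ ω in κ ⁻¹' {i}, stateInd n (X (c (κ ω)) ω) * h ω ∂μ =
      ∫ ω, stateInd n (X (c i) ω) * (κ ⁻¹' {i}).indicator h ω ∂μ := by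
    rw [← integral_indicator hmi]
    congr 1
    ext ω
    by_cases hω : ω ∈ κ ⁻¹' {i}
    · have : κ ω = i := hω
      rw [Set.indicator_of_mem hω, Set.indicator_of_mem hω, this]
    · rw [Set.indicator_of_notMem hω, Set.indicator_of_notMem hω, mul_zero]
  have e2 : ∫ ω in κ ⁻¹' {i}, μ.real {ω' | X (c (κ ω)) ω' = n} * h ω ∂μ =
      μ.real {ω' | X (c i) ω' = n} * ∫ ω, (κ ⁻¹' {i}).indicator h ω ∂μ := by
    rw [integral_indicator hmi, ← integral_const_mul]
    refine setIntegral_congr_fun hmi fun ω hω => ?_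
    have : κ ω = i := hω
    simp only [this]
  have hmeas1 : Measurable[mG] fun ω => stateInd n (X (c i) ω) :=
    (measurable_of_countable (stateInd n)).comp (hX (c i))
  have hmeas2 : Measurable[mF] ((κ ⁻¹' {i}).indicator h) :=
    Measurable.indicator hh (hκ (measurableSet_singleton i))
  have hindep : IndepFun (fun ω => stateInd n (X (c i) ω)) ((κ ⁻¹' {i}).indicator h) μ := by
    rw [IndepFun_iff_Indep]
    exact indep_of_indep_of_le_left (indep_of_indep_of_le_right hind.symm hmeas2.comap_le)
      hmeas1.comap_le
  rw [e1, e2, hindep.integral_fun_mul_eq_mul_integral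
    (hmeas1.mono hG le_rfl).aestronglyMeasurable (hmeas2.mono hF le_rfl).aestronglyMeasurable,
    integral_stateInd_comp (hXm (c i))]

/-- A right-continuous process evaluated at an independent random time. -/
theorem integral_stateInd_comp_age_mul (hF : mF ≤ mΩ) (hG : mG ≤ mΩ) (hind : Indep mF mG μ)
    (hX : ∀ s, Measurable[mG] (X s))
    (hrc : ∀ ω t, ContinuousWithinAt (fun s => X s ω) (Set.Ici t) t)
    (hh : Measurable[mF] h) (hC : ∀ ω, |h ω| ≤ C)
    {s : Ω → ℝ≥0} (hs : Measurable[mF] s) (n : ℕ)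
    (hp : Continuous fun s => μ.real {ω | X s ω = n}) :
    ∫ ω, stateInd n (X (s ω) ω) * h ω ∂μ = ∫ ω, μ.real {ω' | X (s ω) ω' = n} * h ω ∂μ := by
  have hXm : ∀ s, Measurable (X s) := fun s => (hX s).mono hG le_rfl
  have hhm : Measurable h := hh.mono hF le_rfl
  have hsm : Measurable s := hs.mono hF le_rfl
  have hbd : Integrable (fun ω => |h ω|) μ :=
    (Integrable.of_bound hhm.aestronglyMeasurable C (ae_of_all _ hC)).abs
  have hκ := fun j => measurable_floor_mul hsm j
  have hL : Tendsto (fun j : ℕ => ∫ ω, stateInd n (X (gridAbove j ⌊s ω * (j + 1)⌋₊) ω) * h ω ∂μ)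
      atTop (𝓝 (∫ ω, stateInd n (X (s ω) ω) * h ω ∂μ)) := by
    refine tendsto_integral_of_dominated_convergence (fun ω => |h ω|) (fun j => ?_) hbd
      (fun j => ae_of_all _ fun ω => ?_) (ae_of_all _ fun ω => ?_)
    · exact (integrable_stateInd_mul (μ := μ) hhm hC
        (measurable_comp_nat hXm (hκ j) _) n).aestronglyMeasurable
    · rw [Real.norm_eq_abs, abs_mul]
      exact mul_le_of_le_one_left (abs_nonneg _) (abs_stateInd_le_one _ _)
    · refine Tendsto.mul_const _ ?_
      exact ((continuous_of_discreteTopology (f := stateInd n)).tendsto _).comp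
        (tendsto_comp_gridAbove hrc (s ω) ω)
  -- The left side converges by right-continuity of the paths, this one by continuity of the state
  -- probability.
  have hR : Tendsto (fun j : ℕ =>
      ∫ ω, μ.real {ω' | X (gridAbove j ⌊s ω * (j + 1)⌋₊) ω' = n} * h ω ∂μ)
      atTop (𝓝 (∫ ω, μ.real {ω' | X (s ω) ω' = n} * h ω ∂μ)) := by
    refine tendsto_integral_of_dominated_convergence (fun ω => |h ω|) (fun j => ?_) hbd
      (fun j => ae_of_all _ fun ω => ?_) (ae_of_all _ fun ω => ?_)
    · refine Measurable.aestronglyMeasurable (Measurable.mul ?_ hhm)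
      exact (measurable_of_countable fun i => μ.real {ω' | X (gridAbove j i) ω' = n}).comp (hκ j)
    · rw [Real.norm_eq_abs, abs_mul, abs_of_nonneg measureReal_nonneg]
      exact mul_le_of_le_one_left (abs_nonneg _) measureReal_le_one
    · refine Tendsto.mul_const _ ?_
      exact (hp.tendsto (s ω)).comp
        ((tendsto_gridAbove (s ω)).mono_right nhdsWithin_le_nhds)
  refine tendsto_nhds_unique hL (hR.congr fun j => ?_)
  exact (integral_stateInd_comp_nat_mul hF hG hind hX hh hC
    (@measurable_floor_mul Ω mF s hs j) (gridAbove j) n).symm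

end RandomTime

/-! ### The law of the size of a uniformly chosen webpage -/

section PageSize

variable {Ω : Type*} {W : ℕ → Ω → ℝ} {M : ℕ → ℝ≥0 → Ω → ℕ}

/-- The sigma-algebra generated by the holding times of the webpage process. -/
abbrev holdingSigma (W : ℕ → Ω → ℝ) : MeasurableSpace Ω :=
  ⨆ i, MeasurableSpace.comap (W i) inferInstance

/-- The sigma-algebra generated by a single in-link process. -/
abbrev linkSigma (X : ℝ≥0 → Ω → ℕ) : MeasurableSpace Ω :=
  ⨆ s, MeasurableSpace.comap (X s) inferInstance

theorem measurable_holdingSigma (i : ℕ) : Measurable[holdingSigma W] (W i) :=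
  Measurable.of_comap_le (le_iSup (fun i => MeasurableSpace.comap (W i) inferInstance) i)

theorem measurable_linkSigma (X : ℝ≥0 → Ω → ℕ) (s : ℝ≥0) : Measurable[linkSigma X] (X s) :=
  Measurable.of_comap_le (le_iSup (fun s => MeasurableSpace.comap (X s) inferInstance) s)

theorem measurable_holding_networkSigma (i : ℕ) : Measurable[networkSigma W M] (W i) :=
  Measurable.of_comap_le (le_iSup (componentSigma W M) (Sum.inl i))

theorem measurable_link_networkSigma (k : ℕ) (s : ℝ≥0) :
    Measurable[networkSigma W M] (M k s) :=
  (measurable_linkSigma (M k) s).mono (le_iSup (componentSigma W M) (Sum.inr k)) le_rfl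

theorem measurable_creationTime [MeasurableSpace Ω] (hW : ∀ i, Measurable (W i)) (k : ℕ) :
    Measurable (creationTime W k) :=
  Finset.measurable_sum (Finset.range k) fun i _ => hW i

theorem measurable_age [MeasurableSpace Ω] (hW : ∀ i, Measurable (W i)) (t : ℝ≥0) (k : ℕ) :
    Measurable fun ω => ((t : ℝ) - creationTime W k ω).toNNReal :=
  (measurable_const.sub (measurable_creationTime hW k)).real_toNNReal

theorem measurable_pagesAt [MeasurableSpace Ω] (hW : ∀ i, Measurable (W i)) (t : ℝ≥0) :
    Measurable (pagesAt W t) := by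
  refine measurable_set_iff.2 fun k => ?_
  exact measurableSet_setOfPred.1 (measurableSet_le (measurable_creationTime hW k) measurable_const)

open Classical in
/-- The conditional probability, given the network, of choosing webpage `k`. -/
def pageWeight (W : ℕ → Ω → ℝ) (t : ℝ≥0) (k : ℕ) (ω : Ω) : ℝ :=
  if k ∈ pagesAt W t ω then ((pagesAt W t ω).ncard : ℝ)⁻¹ else 0

theorem measurable_pageWeight [MeasurableSpace Ω] (hW : ∀ i, Measurable (W i)) (t : ℝ≥0) (k : ℕ) :
    Measurable (pageWeight W t k) := by
  classical
  refine Measurable.ite ?_ ?_ measurable_const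
  · exact measurableSet_le (measurable_creationTime hW k) measurable_const
  · exact ((measurable_of_countable (fun m : ℕ => (m : ℝ)⁻¹)).comp
      (measurable_ncard.comp (measurable_pagesAt hW t)))

theorem pageWeight_nonneg (t : ℝ≥0) (k : ℕ) (ω : Ω) : 0 ≤ pageWeight W t k ω := by
  unfold pageWeight
  split_ifs <;> positivity

theorem abs_pageWeight_le_one (t : ℝ≥0) (k : ℕ) (ω : Ω) : |pageWeight W t k ω| ≤ 1 := by
  rw [abs_of_nonneg (pageWeight_nonneg t k ω)]
  unfold pageWeight
  split_ifs
  · exact Nat.cast_inv_le_one _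
  · exact zero_le_one

theorem hasSum_pageWeight_mul {ω : Ω} {t : ℝ≥0} (hmono : Monotone fun k => creationTime W k ω)
    (htop : Tendsto (fun k => creationTime W k ω) atTop atTop) (a : ℕ → ℝ) :
    HasSum (fun k => a k * pageWeight W t k ω)
      (((pagesAt W t ω).ncard : ℝ)⁻¹ * ∑ k ∈ Finset.range ((pagesAt W t ω).ncard), a k) := by
  have hset : ∀ k, k ∈ pagesAt W t ω ↔ k < (pagesAt W t ω).ncard :=
    fun k => Set.ext_iff.1 (exists_setOf_le_eq_Iio hmono htop t) k
  have h : ∀ k ∉ Finset.range ((pagesAt W t ω).ncard), a k * pageWeight W t k ω = 0 := by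
    intro k hk
    rw [pageWeight, if_neg, mul_zero]
    rwa [hset, ← Finset.mem_range]
  have e : ((pagesAt W t ω).ncard : ℝ)⁻¹ * ∑ k ∈ Finset.range ((pagesAt W t ω).ncard), a k =
      ∑ k ∈ Finset.range ((pagesAt W t ω).ncard), a k * pageWeight W t k ω := by
    rw [Finset.mul_sum]
    refine Finset.sum_congr rfl fun k hk => ?_
    rw [pageWeight, if_pos ((hset k).2 (Finset.mem_range.1 hk)), mul_comm]
  rw [e]
  exact hasSum_sum_of_ne_finset_zero h

variable [MeasurableSpace Ω] {μ : Measure Ω}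

theorem holdingSigma_le (hW : ∀ i, Measurable (W i)) : holdingSigma W ≤ ‹MeasurableSpace Ω› :=
  iSup_le fun i => (hW i).comap_le

theorem linkSigma_le {X : ℝ≥0 → Ω → ℕ} (hX : ∀ s, Measurable (X s)) :
    linkSigma X ≤ ‹MeasurableSpace Ω› :=
  iSup_le fun s => (hX s).comap_le

namespace IsGeneralizedYuleModel

variable {β ν : ℝ} {r : ℕ → ℝ}

theorem componentSigma_le (h : IsGeneralizedYuleModel μ β ν r W M) (i : ℕ ⊕ ℕ) :
    componentSigma W M i ≤ ‹MeasurableSpace Ω› := by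
  rcases i with i | k
  · exact (h.measurable_holding i).comap_le
  · exact linkSigma_le (h.birth k).measurable

theorem networkSigma_le (h : IsGeneralizedYuleModel μ β ν r W M) :
    networkSigma W M ≤ ‹MeasurableSpace Ω› :=
  iSup_le h.componentSigma_le

theorem indep_holdingSigma_linkSigma (h : IsGeneralizedYuleModel μ β ν r W M) (k : ℕ) :
    Indep (holdingSigma W) (linkSigma (M k)) μ := by
  have h1 := indep_iSup_of_disjoint h.componentSigma_le h.indep
    (S := Set.range Sum.inl) (T := {Sum.inr k}) (by simp)
  refine indep_of_indep_of_le_left (indep_of_indep_of_le_right h1 ?_) ?_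
  · exact le_iSup₂_of_le (Sum.inr k) rfl le_rfl
  · exact iSup_le fun i => le_iSup₂_of_le (Sum.inl i) ⟨i, rfl⟩ le_rfl

theorem measurable_pageSize (h : IsGeneralizedYuleModel μ β ν r W M)
    {t : ℝ≥0} {K : Ω → ℕ}
    (hK : IsUniformPage μ W M t K) : Measurable (pageSize W M t K) := by
  have : Measurable fun p : ℕ × Ω =>
      M p.1 ((t : ℝ) - creationTime W p.1 p.2).toNNReal p.2 :=
    measurable_from_prod_countable_right fun k =>
      measurable_comp_age (h.birth k).measurable (h.birth k).rightCont
        (measurable_age h.measurable_holding t k)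
  exact this.comp (hK.measurable.prodMk measurable_id)

theorem iIndepFun_holding (h : IsGeneralizedYuleModel μ β ν r W M) : iIndepFun W μ :=
  (iIndepFun_iff_iIndep _ _ _).2 (h.indep.precomp Sum.inl_injective)

theorem ae_growth [IsProbabilityMeasure μ] (h : IsGeneralizedYuleModel μ β ν r W M) (hβ : 0 < β) :
    ∀ᵐ ω ∂μ, (Monotone fun k => creationTime W k ω) ∧ ∃ c,
      Tendsto (fun k : ℕ => creationTime W k ω - Real.log (k + 1) / β) atTop (𝓝 c) :=
  (ae_monotone_creationTime hβ h.law_holding).and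
    (ae_exists_tendsto_creationTime_sub_log hβ h.measurable_holding h.law_holding
      h.iIndepFun_holding)

variable [IsProbabilityMeasure μ] {t : ℝ≥0} {K : Ω → ℕ}

/-- The event that page `k` has size `n` is network-measurable, so conditioning replaces the
indicator of `K = k` by `pageWeight`. That weight and the age depend only on the holding times, so
independence replaces the in-link process by its state probability. The age is clipped to `0` for an
absent page, but the weight is then `0`. -/
theorem setIntegral_stateInd_eq (h : IsGeneralizedYuleModel μ β ν r W M)
    (hK : IsUniformPage μ W M t K) (n k : ℕ) :
    ∫ ω in K ⁻¹' {k}, stateInd n (pageSize W M t K ω) ∂μ =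
      ∫ ω, stateProb μ (M k) n (t - creationTime W k ω) * pageWeight W t k ω ∂μ := by
  have hWn : ∀ i, Measurable[networkSigma W M] (W i) := measurable_holding_networkSigma
  have hY : Measurable[networkSigma W M]
      fun ω => M k ((t : ℝ) - creationTime W k ω).toNNReal ω :=
    @measurable_comp_age Ω (networkSigma W M) _ (measurable_link_networkSigma k)
      (h.birth k).rightCont _ (@measurable_age Ω W (networkSigma W M) hWn t k)
  have hKm : MeasurableSet (K ⁻¹' {k}) := hK.measurable (measurableSet_singleton k)
  set A : Set Ω := {ω | M k ((t : ℝ) - creationTime W k ω).toNNReal ω = n} with hA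
  have hmem : ∀ {ω}, ω ∈ A ↔ M k ((t : ℝ) - creationTime W k ω).toNNReal ω = n := Iff.rfl
  have hAn : MeasurableSet[networkSigma W M] A := hY (measurableSet_singleton n)
  have hAm : MeasurableSet A := h.networkSigma_le _ hAn
  have e1 : ∫ ω in K ⁻¹' {k}, stateInd n (pageSize W M t K ω) ∂μ =
      ∫ ω in A, (K ⁻¹' {k}).indicator (fun _ => (1 : ℝ)) ω ∂μ := by
    rw [← integral_indicator hKm, ← integral_indicator hAm]
    congr 1
    ext ω
    by_cases hω : K ω = k
    · rw [Set.indicator_of_mem (show ω ∈ K ⁻¹' {k} from hω)]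
      by_cases hωA : ω ∈ A
      · rw [Set.indicator_of_mem hωA, Set.indicator_of_mem (show ω ∈ K ⁻¹' {k} from hω),
          stateInd, pageSize, hω, if_pos (hmem.1 hωA)]
      · rw [Set.indicator_of_notMem hωA, stateInd, pageSize, hω,
          if_neg (mt hmem.2 hωA)]
    · rw [Set.indicator_of_notMem (show ω ∉ K ⁻¹' {k} from hω)]
      simp [Set.indicator_apply, hω]
  have e2 := setIntegral_condExp (μ := μ) (f := (K ⁻¹' {k}).indicator (fun _ => (1 : ℝ)))
    h.networkSigma_le ((integrable_const 1).indicator hKm) hAn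
  have e3 : ∫ ω in A, (μ⟦K ⁻¹' {k} | networkSigma W M⟧) ω ∂μ = ∫ ω in A, pageWeight W t k ω ∂μ :=
    integral_congr_ae (ae_restrict_of_ae (hK.uniform k))
  have e4 : ∫ ω in A, pageWeight W t k ω ∂μ =
      ∫ ω, stateInd n (M k ((t : ℝ) - creationTime W k ω).toNNReal ω) * pageWeight W t k ω ∂μ := by
    rw [← integral_indicator hAm]
    congr 1
    ext ω
    by_cases hωA : ω ∈ A
    · rw [Set.indicator_of_mem hωA, stateInd, if_pos (hmem.1 hωA), one_mul]
    · rw [Set.indicator_of_notMem hωA, stateInd, if_neg (mt hmem.2 hωA), zero_mul]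
  have hp : Continuous fun s : ℝ≥0 => μ.real {ω | M k s ω = n} := by
    refine (((h.birth k).continuous_stateProb n).comp NNReal.continuous_coe).congr fun s => ?_
    simp [stateProb]
  have hWh : ∀ i, Measurable[holdingSigma W] (W i) := measurable_holdingSigma
  rw [e1, ← e2, e3, e4]
  exact integral_stateInd_comp_age_mul (holdingSigma_le h.measurable_holding)
    (linkSigma_le (h.birth k).measurable) (h.indep_holdingSigma_linkSigma k)
    (measurable_linkSigma (M k)) (h.birth k).rightCont
    (@measurable_pageWeight Ω W (holdingSigma W) hWh t k) (abs_pageWeight_le_one t k)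
    (@measurable_age Ω W (holdingSigma W) hWh t k) n hp

/-- The terms are the probabilities that `K = k`. They dominate the series when sum and expectation
are exchanged. -/
theorem summable_integral_pageWeight (h : IsGeneralizedYuleModel μ β ν r W M)
    (hK : IsUniformPage μ W M t K) : Summable fun k => ∫ ω, pageWeight W t k ω ∂μ := by
  have hs := (hasSum_setIntegral_fiber (integrable_const (μ := μ) (1 : ℝ)) hK.measurable).summable
  refine hs.congr fun k => ?_
  have hKm : MeasurableSet (K ⁻¹' {k}) := hK.measurable (measurableSet_singleton k)
  rw [← integral_indicator hKm, ← integral_condExp h.networkSigma_le]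
  exact integral_congr_ae (hK.uniform k)

theorem integrable_stateProb_mul_pageWeight (h : IsGeneralizedYuleModel μ β ν r W M)
    (t : ℝ≥0) (n k : ℕ) : Integrable
      (fun ω => stateProb μ (M k) n (t - creationTime W k ω) * pageWeight W t k ω) μ := by
  refine Integrable.bdd_mul (c := 1) (Integrable.of_bound
    (measurable_pageWeight h.measurable_holding t k).aestronglyMeasurable 1
    (ae_of_all _ (abs_pageWeight_le_one t k))) ?_ (ae_of_all _ fun ω => abs_stateProb_le_one n _)
  exact (((h.birth k).continuous_stateProb n).measurable.comp
    (measurable_const.sub (measurable_creationTime h.measurable_holding k))).aestronglyMeasurable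

/-- The law of the size of a uniformly chosen webpage as the expected average of a state
probability over the ages of the webpages. -/
theorem prob_pageSize_eq (h : IsGeneralizedYuleModel μ β ν r W M) (hr : ∀ n, 0 ≤ r n)
    (h0 : 0 < ν) (h1 : ν ≤ 1) (hK : IsUniformPage μ W M t K) (n : ℕ) :
    μ.real {ω | pageSize W M t K ω = n} =
      ∫ ω, ∑' k, stateProb μ (M 0) n (t - creationTime W k ω) * pageWeight W t k ω ∂μ := by
  rw [← integral_stateInd_comp (h.measurable_pageSize hK) n]
  have hint : Integrable (fun ω => stateInd n (pageSize W M t K ω)) μ :=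
    Integrable.of_bound ((measurable_of_countable (stateInd n)).comp
      (h.measurable_pageSize hK)).aestronglyMeasurable 1
      (ae_of_all _ fun ω => abs_stateInd_le_one _ _)
  have hs := hasSum_setIntegral_fiber hint hK.measurable
  simp_rw [h.setIntegral_stateInd_eq hK n,
    fun k => (h.birth k).stateProb_eq (h.birth 0) hr h0 h1 n] at hs
  have hI : ∀ k, Integrable
      (fun ω => stateProb μ (M 0) n (t - creationTime W k ω) * pageWeight W t k ω) μ := fun k => by
    rw [← (h.birth k).stateProb_eq (h.birth 0) hr h0 h1 n]
    exact h.integrable_stateProb_mul_pageWeight t n k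
  refine hs.unique (hasSum_integral_of_summable_integral_norm hI ?_)
  refine Summable.of_nonneg_of_le (fun k => integral_nonneg fun ω => norm_nonneg _) (fun k => ?_)
    (h.summable_integral_pageWeight hK)
  refine integral_mono (hI k).norm (Integrable.of_bound
    (measurable_pageWeight h.measurable_holding t k).aestronglyMeasurable 1
    (ae_of_all _ (abs_pageWeight_le_one t k))) fun ω => ?_
  simp only [norm_mul, Real.norm_eq_abs, abs_of_nonneg (pageWeight_nonneg t k ω)]
  exact mul_le_of_le_one_left (pageWeight_nonneg t k ω) (abs_stateProb_le_one n _)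

/-- The size of a uniformly chosen webpage converges in law to the number of in-links at an
independent exponential age. -/
theorem tendsto_prob_pageSize (h : IsGeneralizedYuleModel μ β ν r W M) (hβ : 0 < β)
    (hr : ∀ n, 0 ≤ r n) (h0 : 0 < ν) (h1 : ν ≤ 1) {K : ℝ≥0 → Ω → ℕ}
    (hK : ∀ t, IsUniformPage μ W M t (K t)) (n : ℕ) :
    Tendsto (fun t : ℝ≥0 => μ.real {ω | pageSize W M t (K t) ω = n}) atTop
      (𝓝 (∫ s in Set.Ioi (0 : ℝ), β * Real.exp (-(β * s)) * stateProb μ (M 0) n s)) := by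
  have hcont := (h.birth 0).continuous_stateProb n
  have hgrow := h.ae_growth hβ
  have hsum : ∀ᵐ ω ∂μ, ∀ t : ℝ≥0, HasSum
      (fun k => stateProb μ (M 0) n (t - creationTime W k ω) * pageWeight W t k ω)
      (((pagesAt W t ω).ncard : ℝ)⁻¹ * ∑ k ∈ Finset.range ((pagesAt W t ω).ncard),
        stateProb μ (M 0) n (t - creationTime W k ω)) := by
    filter_upwards [hgrow] with ω ⟨hmono, c, hc⟩ t
    exact hasSum_pageWeight_mul hmono (tendsto_atTop_of_sub_log hβ hc) _
  have hlim : Tendsto (fun t : ℝ≥0 => ∫ ω,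
      ∑' k, stateProb μ (M 0) n (t - creationTime W k ω) * pageWeight W t k ω ∂μ) atTop
      (𝓝 (∫ _ : Ω, (∫ s in Set.Ioi (0 : ℝ),
        β * Real.exp (-(β * s)) * stateProb μ (M 0) n s) ∂μ)) := by
    -- Averages of state probabilities lie in `[0, 1]`, so the almost sure convergence of the age
    -- averages passes to expectations.
    refine tendsto_integral_filter_of_dominated_convergence (fun _ => 1) ?_ ?_
      (integrable_const 1) ?_
    · refine Eventually.of_forall fun t => ?_
      refine aestronglyMeasurable_of_tendsto_ae atTop (f := fun (m : ℕ) ω =>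
        ∑ k ∈ Finset.range m,
          stateProb μ (M 0) n (t - creationTime W k ω) * pageWeight W t k ω) (fun m => ?_) ?_
      · refine (Finset.measurable_sum _ fun k _ => ?_).aestronglyMeasurable
        exact (hcont.measurable.comp (measurable_const.sub
          (measurable_creationTime h.measurable_holding k))).mul
          (measurable_pageWeight h.measurable_holding t k)
      · filter_upwards [hsum] with ω hω
        exact (hω t).summable.hasSum.tendsto_sum_nat
    · refine Eventually.of_forall fun t => ?_
      filter_upwards [hsum] with ω hω
      rw [(hω t).tsum_eq, Real.norm_of_nonneg (mul_nonneg (by positivity)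
        (Finset.sum_nonneg fun k _ => stateProb_nonneg n _))]
      have hle : ∑ k ∈ Finset.range ((pagesAt W t ω).ncard),
          stateProb μ (M 0) n (t - creationTime W k ω) ≤ ((pagesAt W t ω).ncard : ℝ) := by
        refine (Finset.sum_le_sum fun k _ => stateProb_le_one n _).trans ?_
        simp
      exact (mul_le_mul_of_nonneg_left hle (by positivity)).trans inv_mul_le_one
    · filter_upwards [hgrow, hsum] with ω ⟨hmono, c, hc⟩ hω
      have hav := (tendsto_average_ages hβ hmono hc hcont (C := 1)
        (abs_stateProb_le_one n)).comp (NNReal.tendsto_coe_atTop.2 tendsto_id)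
      refine hav.congr fun t => ?_
      exact (hω t).tsum_eq.symm
  simp only [integral_const, probReal_univ, one_smul] at hlim
  exact hlim.congr fun t => (h.prob_pageSize_eq hr h0 h1 (hK t) n).symm

end IsGeneralizedYuleModel

end PageSize

/-! ### Saturating rates and the main theorem -/

theorem saturatingRate_nonneg {lam : ℝ} (hlam : 0 ≤ lam) (N n : ℕ) :
    0 ≤ saturatingRate lam N n :=
  mul_nonneg hlam (Nat.cast_nonneg _)

end FracYule

end

theorem mainTheorem6 {Ω : Type*} [MeasurableSpace Ω] (μ : Measure Ω) [IsProbabilityMeasure μ]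
    (β lam ν : ℝ) (hβ : 0 < β) (hlam : 0 < lam) (hν0 : 0 < ν) (hν1 : ν ≤ 1)
    (N : ℕ) (hN : 1 ≤ N)
    (W : ℕ → Ω → ℝ) (M : ℕ → ℝ≥0 → Ω → ℕ) (K : ℝ≥0 → Ω → ℕ)
    (hModel : FracYule.IsGeneralizedYuleModel μ β ν (FracYule.saturatingRate lam N) W M)
    (hK : ∀ t, FracYule.IsUniformPage μ W M t (K t))
    (ρ : ℝ) (hρ : ρ = lam / β ^ ν) :
    ∃ π : ProbabilityMeasure ℕ,
      (∀ n : ℕ, Tendsto (fun t : ℝ≥0 => μ.real {ω | FracYule.pageSize W M t (K t) ω = n})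
        atTop (𝓝 ((π : Measure ℕ).real {n}))) ∧
      ∀ n : ℕ, 1 ≤ n → n ≤ N →
        (π : Measure ℕ).real {n} =
          ((N - 1).choose (N - n) : ℝ) *
            ∑ m ∈ Finset.Icc 1 n, ((n - 1).choose (m - 1) : ℝ) * (-1) ^ (n - m) *
              (1 / (1 + ρ * ((N : ℝ) - (m : ℝ)))) := by
  have hr := FracYule.saturatingRate_nonneg hlam.le N
  have hρ0 : 0 ≤ ρ := by
    rw [hρ]
    positivity
  set L : ℕ → ℝ := fun n => ∫ s in Set.Ioi (0 : ℝ),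
    β * Real.exp (-(β * s)) * FracYule.stateProb μ (M 0) n s with hL
  have hL0 : L 0 = 0 := by
    simp [hL, (hModel.birth 0).stateProb_zero]
  have hLnonneg : ∀ n, 0 ≤ L n := fun n => integral_nonneg fun s =>
    mul_nonneg (mul_nonneg hβ.le (Real.exp_pos _).le) (FracYule.stateProb_nonneg n s)
  have hrate : ∀ n, FracYule.saturatingRate lam N n / β ^ ν = ρ * ((N - n : ℕ) : ℝ) := fun n => by
    rw [hρ, FracYule.saturatingRate]
    ring
  have hrec : ∀ n, 1 ≤ n → L n * (1 + ρ * ((N - n : ℕ) : ℝ)) =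
      (if n = 1 then 1 else 0) + ρ * ((N - (n - 1) : ℕ) : ℝ) * L (n - 1) := fun n hn => by
    rw [← hrate, ← hrate]
    exact (hModel.birth 0).laplace_stateProb hν0 hν1 hβ hn
  -- Total mass one on `{0, …, N}` makes the pointwise limits a probability law.
  obtain ⟨π, hπ⟩ := FracYule.exists_probabilityMeasure_of_sum_eq_one hLnonneg
    (FracYule.sum_eq_one_of_recursion hN hL0 hrec)
    fun n hn => FracYule.eq_zero_of_recursion hN hrec hn
  refine ⟨π, fun n => ?_, fun n hn hnN => ?_⟩
  · rw [hπ]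
    exact hModel.tendsto_prob_pageSize hβ hr hν0 hν1 hK n
  · rw [hπ]
    exact FracYule.eq_limitWeight_of_recursion hρ0 hL0 hrec hn hnN
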